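/- Let $e$ be a Hermite–Biehler function, i.e. an entire function with $|e(z)|>|e(\bar z)|$ for all $z\in\mathbb C^+=\{\operatorname{Im} z>0\}$, write $f^\#(z)=\overline{f(\bar z)}$, and let $$\mathcal B=\{f \text{ entire}: f/e,\ f^\#/e\in H_2(\mathbb C^+)\},\qquad \langle g,f\rangle=\int_{\mathbb R}\frac{\overline{g(x)}f(x)}{|e(x)|^2}\,dx,$$ be the de Branges space generated by $e$, where $H_2(\mathbb C^+)$ is the space of holomorphic $F$ on $\mathbb C^+$ with $\sup_{y>0}\int_{\mathbb R}|F(x+iy)|^2dx<\infty$. Let $S$ be the operator of multiplication by the independent variable in $\mathcal B$, with domain $\{f\in\mathcal B: zf(z)\in\mathcal B\}$. For $\beta\in[0,\pi)$ put $s_\beta(z)=\frac i2\left[e^{i\beta}e(z)-e^{-i\beta}e^\#(z)\right]$. Theorem. Assume that $s_0\in\mathcal B$. Then for every $\beta\in(0,\pi)$ the relation consisting of all pairs $(g,h)\in\mathcal B\times\mathcal B$ with $$g(z)=\frac{s_\beta(w)f(z)-s_\beta(z)f(w)}{\sin\beta\,(z-w)},\qquad h(z)=zg(z)+\frac{1}{\sin\beta}f(w)s_\beta(z)$$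 for some $f\in\mathcal B$ and $w\in\mathbb C$ is the graph of a selfadjoint operator $S_\beta$ extending $S$, and $s_0$ is a generating vector for $S_\beta$: if $E$ denotes the resolution of the identity of $S_\beta$ (so that $S_\beta=\int_{\mathbb R}t\,dE(t)$), then the linear span of the vectors $E([a,b))s_0$, $a,b\in\mathbb R$, is dense in $\mathcal B$. -/

import Mathlib

open MeasureTheory Filter Topology
open scoped ComplexConjugate ENNReal

noncomputable section

/-- A Hermite-Biehler function: an entire function `e` with `|e(z)| > |e(z̄)|` in the open upper
half-plane. -/
structure HermiteBiehler where
  toFun : ℂ → ℂ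
  differentiable : Differentiable ℂ toFun
  norm_conj_lt : ∀ z : ℂ, 0 < z.im → ‖toFun (conj z)‖ < ‖toFun z‖

instance : CoeFun HermiteBiehler (fun _ => ℂ → ℂ) := ⟨HermiteBiehler.toFun⟩

/-- The conjugate function `f^#(z) = conj (f (conj z))`. -/
def sharp (f : ℂ → ℂ) : ℂ → ℂ := fun z => conj (f (conj z))

/-- The Hardy space `H_2` of the open upper half-plane. -/
def IsHardyH2 (F : ℂ → ℂ) : Prop :=
  DifferentiableOn ℂ F {z : ℂ | 0 < z.im} ∧
    (⨆ (y : ℝ) (_ : 0 < y), ∫⁻ x : ℝ, ‖F ((x : ℂ) + (y : ℂ) * Complex.I)‖ₑ ^ 2) < ∞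

theorem IsHardyH2.zero : IsHardyH2 (fun _ => 0) := by
  refine ⟨differentiableOn_const 0, ?_⟩
  simp

theorem IsHardyH2.const_mul {F : ℂ → ℂ} (c : ℂ) (hF : IsHardyH2 F) :
    IsHardyH2 (fun z => c * F z) := by
  refine ⟨hF.1.const_mul c, ?_⟩
  have h : ∀ y : ℝ, ∫⁻ x : ℝ, ‖c * F ((x : ℂ) + (y : ℂ) * Complex.I)‖ₑ ^ 2 =
      ‖c‖ₑ ^ 2 * ∫⁻ x : ℝ, ‖F ((x : ℂ) + (y : ℂ) * Complex.I)‖ₑ ^ 2 := by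
    intro y
    rw [← lintegral_const_mul' _ _ (by simp)]
    simp only [enorm_mul, mul_pow]
  simp only [h, ← ENNReal.mul_iSup]
  exact ENNReal.mul_lt_top (by simp [lt_top_iff_ne_top]) hF.2

theorem IsHardyH2.continuous_line {F : ℂ → ℂ} (hF : IsHardyH2 F) {y : ℝ} (hy : 0 < y) :
    Continuous (fun x : ℝ => F ((x : ℂ) + (y : ℂ) * Complex.I)) := by
  refine hF.1.continuousOn.comp_continuous (by fun_prop) ?_
  intro x
  simpa using hy

theorem IsHardyH2.add {F G : ℂ → ℂ} (hF : IsHardyH2 F) (hG : IsHardyH2 G) :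
    IsHardyH2 (fun z => F z + G z) := by
  refine ⟨hF.1.add hG.1, ?_⟩
  have key : ∀ a b : ℝ≥0∞, (a + b) ^ 2 ≤ 2 * a ^ 2 + 2 * b ^ 2 := by
    intro a b
    have := ENNReal.rpow_add_le_mul_rpow_add_rpow a b (p := 2) (by norm_num)
    norm_num [mul_add] at this
    simpa using this
  refine lt_of_le_of_lt (iSup₂_le (fun y hy => ?_)) (ENNReal.add_lt_top.2
    ⟨ENNReal.mul_lt_top (by simp : (2 : ℝ≥0∞) < ∞) hF.2,
      ENNReal.mul_lt_top (by simp : (2 : ℝ≥0∞) < ∞) hG.2⟩)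
  have hFm := (hF.continuous_line hy).measurable.enorm.pow_const 2
  calc ∫⁻ x : ℝ, ‖F ((x : ℂ) + (y : ℂ) * Complex.I) + G ((x : ℂ) + (y : ℂ) * Complex.I)‖ₑ ^ 2
      ≤ ∫⁻ x : ℝ, (2 * ‖F ((x : ℂ) + (y : ℂ) * Complex.I)‖ₑ ^ 2 +
          2 * ‖G ((x : ℂ) + (y : ℂ) * Complex.I)‖ₑ ^ 2) := by
        refine lintegral_mono fun x => le_trans ?_ (key _ _)
        gcongr
        exact enorm_add_le _ _
    _ = 2 * (∫⁻ x : ℝ, ‖F ((x : ℂ) + (y : ℂ) * Complex.I)‖ₑ ^ 2) +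
          2 * ∫⁻ x : ℝ, ‖G ((x : ℂ) + (y : ℂ) * Complex.I)‖ₑ ^ 2 := by
        rw [lintegral_add_left (hFm.const_mul 2), lintegral_const_mul' _ _ (by simp),
          lintegral_const_mul' _ _ (by simp)]
    _ ≤ _ := by
        gcongr
        · exact le_iSup₂ (f := fun (y : ℝ) (_ : 0 < y) =>
            ∫⁻ x : ℝ, ‖F ((x : ℂ) + (y : ℂ) * Complex.I)‖ₑ ^ 2) y hy
        · exact le_iSup₂ (f := fun (y : ℝ) (_ : 0 < y) =>
            ∫⁻ x : ℝ, ‖G ((x : ℂ) + (y : ℂ) * Complex.I)‖ₑ ^ 2) y hy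

namespace HermiteBiehler

variable (e : HermiteBiehler)

/-- The functions `s_β = (i/2) (e^{iβ} e - e^{-iβ} e^#)`. -/
def s (β : ℝ) : ℂ → ℂ := fun z =>
  Complex.I / 2 * (Complex.exp (Complex.I * β) * e z - Complex.exp (-(Complex.I * β)) * sharp e z)

/-- The linear space of entire functions `f` such that `f / e` and `f^# / e` lie in the Hardy
space `H_2` of the upper half-plane. -/
def functions : Submodule ℂ (ℂ → ℂ) where
  carrier := {f | Differentiable ℂ f ∧ IsHardyH2 (fun z => f z / e z) ∧
    IsHardyH2 (fun z => sharp f z / e z)}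
  zero_mem' := by
    refine ⟨differentiable_const 0, ?_, ?_⟩
    · simpa using IsHardyH2.zero
    · simpa [sharp] using IsHardyH2.zero
  add_mem' := by
    rintro f g ⟨hf, hf1, hf2⟩ ⟨hg, hg1, hg2⟩
    refine ⟨hf.add hg, ?_, ?_⟩
    · simpa [add_div] using hf1.add hg1
    · simpa [sharp, add_div] using hf2.add hg2
  smul_mem' := by
    rintro c f ⟨hf, hf1, hf2⟩
    refine ⟨hf.const_smul c, ?_, ?_⟩
    · simpa [mul_div_assoc] using hf1.const_mul c
    · simpa [sharp, mul_div_assoc] using hf2.const_mul (conj c)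

/-- The de Branges space `B(e)`. -/
def Space : Type := ↥e.functions

instance : AddCommGroup e.Space := inferInstanceAs (AddCommGroup ↥e.functions)

instance : Module ℂ e.Space := inferInstanceAs (Module ℂ ↥e.functions)

instance : FunLike e.Space ℂ ℂ where
  coe f := Subtype.val (p := fun h => h ∈ e.functions) f
  coe_injective := Subtype.val_injective

variable {e}

/-- An element of the linear space `e.functions`, viewed in `B(e)`. -/
def Space.mk (f : ℂ → ℂ) (hf : f ∈ e.functions) : e.Space :=
  (⟨f, hf⟩ : ↥e.functions)

theorem Space.mem (f : e.Space) : ⇑f ∈ e.functions :=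
  Subtype.property (p := fun h => h ∈ e.functions) f

theorem Space.coe_mk (f : ℂ → ℂ) (hf : f ∈ e.functions) : ⇑(Space.mk f hf) = f := rfl

theorem Space.zero_apply (z : ℂ) : (0 : e.Space) z = 0 := rfl

theorem Space.add_apply (f g : e.Space) (z : ℂ) : (f + g) z = f z + g z := rfl

theorem Space.smul_apply (c : ℂ) (f : e.Space) (z : ℂ) : (c • f) z = c * f z := rfl

theorem ne_zero {z : ℂ} (hz : 0 < z.im) : e z ≠ 0 := by
  have := (norm_nonneg _).trans_lt (e.norm_conj_lt z hz)
  simpa using this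

/-- An entire function whose real zeros accumulate at `0` vanishes identically. -/
theorem eq_zero_of_frequently_real {f : ℂ → ℂ} (hf : Differentiable ℂ f)
    (h : ∃ᶠ x : ℝ in 𝓝[≠] 0, f x = 0) : f = 0 := by
  have hA : AnalyticOnNhd ℂ f Set.univ := fun z _ => hf.analyticAt z
  have hB : AnalyticOnNhd ℂ (0 : ℂ → ℂ) Set.univ := fun z _ => analyticAt_const
  refine hA.eq_of_frequently_eq (z₀ := 0) hB ?_
  have ht : Tendsto (fun x : ℝ => (x : ℂ)) (𝓝[≠] 0) (𝓝[≠] 0) := by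
    refine tendsto_nhdsWithin_iff.2 ⟨?_, ?_⟩
    · exact (Complex.continuous_ofReal.tendsto' 0 0 (by simp)).mono_left nhdsWithin_le_nhds
    · filter_upwards [self_mem_nhdsWithin] with x hx
      simpa using hx
  exact ht.frequently h

theorem ae_real_ne_zero : ∀ᵐ x : ℝ, e x ≠ 0 := by
  have hA : AnalyticOnNhd ℝ (fun x : ℝ => e x) Set.univ := by
    intro x _
    exact ((e.differentiable.analyticAt (x : ℂ)).restrictScalars (𝕜 := ℝ)).comp
      (Complex.ofRealCLM.analyticAt x)
  obtain ⟨x, hx⟩ : ∃ x : ℝ, e x ≠ 0 := by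
    by_contra! hcon
    have h0 := eq_zero_of_frequently_real e.differentiable (Eventually.of_forall hcon).frequently
    exact ne_zero (e := e) (z := Complex.I) (by simp) (by rw [h0]; rfl)
  have := hA.preimage_zero_mem_codiscrete (x := x) hx
  have h2 := ae_restrict_le_codiscreteWithin (μ := (volume : Measure ℝ)) MeasurableSet.univ this
  rw [Measure.restrict_univ] at h2
  filter_upwards [h2] with y hy
  simpa using hy

theorem memLp_div (f : e.Space) : MemLp (fun x : ℝ => f x / e x) 2 := by
  have hmeas : Measurable (fun x : ℝ => f x / e x) :=
    (f.mem.1.continuous.comp Complex.continuous_ofReal).measurable.div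
      (e.differentiable.continuous.comp Complex.continuous_ofReal).measurable
  refine ⟨hmeas.aestronglyMeasurable, ?_⟩
  rw [eLpNorm_lt_top_iff_lintegral_rpow_enorm_lt_top (by norm_num) (by norm_num)]
  set C := ⨆ (y : ℝ) (_ : 0 < y),
    ∫⁻ x : ℝ, ‖f ((x : ℂ) + (y : ℂ) * Complex.I) / e ((x : ℂ) + (y : ℂ) * Complex.I)‖ₑ ^ 2 with hC
  have hC' : C < ∞ := f.mem.2.1.2
  set u : ℕ → ℝ := fun n => 1 / ((n : ℝ) + 1) with hu
  have hupos : ∀ n, 0 < u n := fun n => by positivity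
  have hu0 : Tendsto u atTop (𝓝 0) := tendsto_one_div_add_atTop_nhds_zero_nat
  have hlim : ∀ᵐ x : ℝ, ‖f x / e x‖ₑ ^ 2 ≤ liminf (fun n : ℕ =>
      ‖f ((x : ℂ) + (u n : ℂ) * Complex.I) / e ((x : ℂ) + (u n : ℂ) * Complex.I)‖ₑ ^ 2) atTop := by
    filter_upwards [ae_real_ne_zero (e := e)] with x hx
    have h1 : Tendsto (fun n : ℕ => (x : ℂ) + (u n : ℂ) * Complex.I) atTop (𝓝 (x : ℂ)) := by
      have : Continuous (fun y : ℝ => (x : ℂ) + (y : ℂ) * Complex.I) := by fun_prop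
      exact (this.tendsto' 0 (x : ℂ) (by simp)).comp hu0
    have h2 := ((f.mem.1.continuous.tendsto (x : ℂ)).comp h1).div
      ((e.differentiable.continuous.tendsto (x : ℂ)).comp h1) hx
    have h3 := ((ENNReal.continuous_pow 2).tendsto _).comp h2.enorm
    exact h3.liminf_eq.ge
  calc ∫⁻ x : ℝ, ‖f x / e x‖ₑ ^ (2 : ℝ≥0∞).toReal
      = ∫⁻ x : ℝ, ‖f x / e x‖ₑ ^ 2 := by simp
    _ ≤ ∫⁻ x : ℝ, liminf (fun n : ℕ =>
      ‖f ((x : ℂ) + (u n : ℂ) * Complex.I) / e ((x : ℂ) + (u n : ℂ) * Complex.I)‖ₑ ^ 2) atTop :=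
        lintegral_mono_ae hlim
    _ ≤ liminf (fun n : ℕ => ∫⁻ x : ℝ,
      ‖f ((x : ℂ) + (u n : ℂ) * Complex.I) / e ((x : ℂ) + (u n : ℂ) * Complex.I)‖ₑ ^ 2) atTop :=
        lintegral_liminf_le fun n =>
          (f.mem.2.1.continuous_line (hupos n)).measurable.enorm.pow_const 2
    _ ≤ C := by
        refine liminf_le_of_le (by isBoundedDefault) fun b hb => ?_
        obtain ⟨n, hn⟩ := hb.exists
        exact hn.trans (le_iSup₂ (f := fun (y : ℝ) (_ : 0 < y) => ∫⁻ x : ℝ,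
          ‖f ((x : ℂ) + (y : ℂ) * Complex.I) / e ((x : ℂ) + (y : ℂ) * Complex.I)‖ₑ ^ 2)
          (u n) (hupos n))
    _ < ∞ := hC'

theorem integrand_eq (a b c : ℂ) :
    conj a * b / ((‖c‖ ^ 2 : ℝ) : ℂ) = conj (a / c) * (b / c) := by
  rw [map_div₀, div_mul_div_comm, Complex.conj_mul']
  push_cast
  rfl

theorem integrable_integrand (f g : e.Space) :
    Integrable (fun x : ℝ => conj (f x) * g x / ((‖e x‖ ^ 2 : ℝ) : ℂ)) := by
  refine ((memLp_div f).star.integrable_mul (memLp_div g)).congr (Eventually.of_forall fun x => ?_)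
  exact (integrand_eq (f x) (g x) (e x)).symm

variable (e) in
/-- The inner product `⟨f, g⟩ = ∫ conj (f(x)) g(x) / |e(x)|² dx`. -/
@[reducible]
def innerCore : InnerProductSpace.Core ℂ e.Space where
  inner f g := ∫ x : ℝ, conj (f x) * g x / ((‖e x‖ ^ 2 : ℝ) : ℂ)
  conj_inner_symm f g := by
    rw [← integral_conj]
    congr 1
    ext x
    simp only [map_div₀, map_mul, Complex.conj_conj, Complex.conj_ofReal]
    ring
  re_inner_nonneg f := by
    have h : ∀ x : ℝ, conj (f x) * f x / ((‖e x‖ ^ 2 : ℝ) : ℂ) =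
        ((‖f x‖ ^ 2 / ‖e x‖ ^ 2 : ℝ) : ℂ) := by
      intro x
      rw [mul_comm, Complex.mul_conj, Complex.normSq_eq_norm_sq]
      push_cast
      rfl
    simp only [h]
    rw [integral_complex_ofReal, RCLike.re_eq_complex_re, Complex.ofReal_re]
    exact integral_nonneg fun x => by positivity
  add_left f g h := by
    rw [← integral_add (integrable_integrand f h) (integrable_integrand g h)]
    congr 1
    ext x
    rw [Space.add_apply, map_add]
    ring
  smul_left f g c := by
    rw [← integral_const_mul]
    congr 1
    ext x
    rw [Space.smul_apply, map_mul]
    ring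
  definite f hf := by
    have h : ∀ x : ℝ, conj (f x) * f x / ((‖e x‖ ^ 2 : ℝ) : ℂ) = ((‖f x / e x‖ ^ 2 : ℝ) : ℂ) := by
      intro x
      rw [mul_comm, Complex.mul_conj, Complex.normSq_eq_norm_sq, norm_div, div_pow]
      push_cast
      rfl
    simp only [h] at hf
    rw [integral_complex_ofReal] at hf
    have hf' : ∫ x : ℝ, ‖f x / e x‖ ^ 2 = 0 := by exact_mod_cast hf
    have hint : Integrable (fun x : ℝ => ‖f x / e x‖ ^ 2) :=
      (memLp_two_iff_integrable_sq_norm (memLp_div f).1).1 (memLp_div f)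
    rw [integral_eq_zero_iff_of_nonneg (fun x => by positivity) hint] at hf'
    have h0 : ∀ᵐ x : ℝ, f x = 0 := by
      filter_upwards [hf', ae_real_ne_zero (e := e)] with x hx hex
      simpa [hex] using hx
    have hcont : Continuous (fun x : ℝ => f x) := f.mem.1.continuous.comp Complex.continuous_ofReal
    have h1 : (fun x : ℝ => f x) = fun _ => 0 :=
      (hcont.ae_eq_iff_eq volume continuous_const).1 h0
    exact DFunLike.coe_injective (eq_zero_of_frequently_real f.mem.1
      (Eventually.of_forall fun x => congrFun h1 x).frequently)

instance : NormedAddCommGroup e.Space := (innerCore e).toNormedAddCommGroup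

instance : InnerProductSpace ℂ e.Space := InnerProductSpace.ofCore (innerCore e).toCore

theorem inner_def (f g : e.Space) :
    inner ℂ f g = ∫ x : ℝ, conj (f x) * g x / ((‖e x‖ ^ 2 : ℝ) : ℂ) := rfl

variable (e)

/-- The operator `S` of multiplication by the independent variable, on its maximal domain. -/
def mulOp : e.Space →ₗ.[ℂ] e.Space where
  domain :=
    { carrier := {f | (fun z => z * f z) ∈ e.functions}
      zero_mem' := by
        have h : (fun z : ℂ => z * (0 : e.Space) z) = 0 := funext fun z => mul_zero z
        change (fun z : ℂ => z * (0 : e.Space) z) ∈ e.functions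
        rw [h]
        exact e.functions.zero_mem
      add_mem' := by
        intro f g hf hg
        have h : (fun z : ℂ => z * (f + g) z) = (fun z => z * f z) + fun z => z * g z :=
          funext fun z => mul_add z (f z) (g z)
        change (fun z : ℂ => z * (f + g) z) ∈ e.functions
        rw [h]
        exact e.functions.add_mem hf hg
      smul_mem' := by
        intro c f hf
        have h : (fun z : ℂ => z * (c • f) z) = c • fun z => z * f z :=
          funext fun z => mul_left_comm z c (f z)
        change (fun z : ℂ => z * (c • f) z) ∈ e.functions
        rw [h]
        exact e.functions.smul_mem c hf }
  toFun :=
    { toFun := fun f => Space.mk (fun z => z * (f : e.Space) z) f.2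
      map_add' := fun f g => DFunLike.coe_injective
        (funext fun z => mul_add z ((f : e.Space) z) ((g : e.Space) z))
      map_smul' := fun c f => DFunLike.coe_injective
        (funext fun z => mul_left_comm z c ((f : e.Space) z)) }

/-- The graph of `S_β`, `β ∈ (0, π)`: the pairs `(g, h)` of elements of `B(e)` with
`g(z) = (s_β(w) f(z) - s_β(z) f(w)) / (sin β (z - w))` and
`h(z) = z g(z) + f(w) s_β(z) / sin β`, for some `f ∈ B(e)` and `w ∈ ℂ`. -/
def extensionGraph (β : ℝ) : Set (e.Space × e.Space) :=
  {p | ∃ (f : e.Space) (w : ℂ),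
    (∀ z : ℂ, z ≠ w →
      p.1 z = (e.s β w * f z - e.s β z * f w) / ((Real.sin β : ℂ) * (z - w))) ∧
    ∀ z : ℂ, p.2 z = z * p.1 z + 1 / (Real.sin β : ℂ) * f w * e.s β z}

end HermiteBiehler

section OperatorTheory

variable {H : Type*} [NormedAddCommGroup H] [InnerProductSpace ℂ H]

/-- `A` is densely defined and equals its adjoint (as linear relations in `H`, i.e. in terms of
graphs). -/
def IsSelfAdjointOperator (A : H →ₗ.[ℂ] H) : Prop :=
  Dense (A.domain : Set H) ∧ A.graph.adjoint = A.graph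

variable (H) in
/-- A projection-valued measure on the Borel sets of `ℝ`. Values on sets that are not
Borel are irrelevant. -/
structure ProjectionValuedMeasure where
  proj : Set ℝ → H →L[ℂ] H
  isProjection : ∀ t, MeasurableSet t → (proj t : H →ₗ[ℂ] H).IsSymmetricProjection
  proj_univ : proj Set.univ = ContinuousLinearMap.id ℂ H
  proj_inter : ∀ t u, MeasurableSet t → MeasurableSet u → proj (t ∩ u) = proj t ∘L proj u
  hasSum_proj : ∀ t : ℕ → Set ℝ, (∀ n, MeasurableSet (t n)) →
    Pairwise (Function.onFun Disjoint t) →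
    ∀ x : H, HasSum (fun n => proj (t n) x) (proj (⋃ n, t n) x)

namespace ProjectionValuedMeasure

variable (E : ProjectionValuedMeasure H)

theorem proj_empty (x : H) : E.proj ∅ x = 0 := by
  have h := E.hasSum_proj (fun _ => ∅) (fun _ => MeasurableSet.empty)
    (fun _ _ _ => disjoint_bot_left) x
  exact (summable_const_iff _).1 h.summable

theorem re_inner_nonneg {t : Set ℝ} (ht : MeasurableSet t) (x : H) :
    0 ≤ (inner ℂ x (E.proj t x)).re := by
  have h := E.isProjection t ht
  have h1 : E.proj t (E.proj t x) = E.proj t x := by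
    have := E.proj_inter t t ht ht
    rw [Set.inter_self] at this
    exact (congrArg (fun T : H →L[ℂ] H => T x) this).symm
  have h2 : inner ℂ (E.proj t x) (E.proj t x) = inner ℂ x (E.proj t (E.proj t x)) :=
    h.isSymmetric x (E.proj t x)
  rw [h1] at h2
  rw [← h2]
  exact inner_self_nonneg (𝕜 := ℂ)

/-- The finite Borel measure `Δ ↦ ⟨x, E(Δ) x⟩`. -/
def scalarMeasure (x : H) : Measure ℝ :=
  Measure.ofMeasurable (fun t _ => ENNReal.ofReal (inner ℂ x (E.proj t x)).re)
    (by simp [E.proj_empty])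
    (by
      intro t ht hd
      have h : HasSum (fun n => (inner ℂ x (E.proj (t n) x)).re)
          (inner ℂ x (E.proj (⋃ n, t n) x)).re :=
        Complex.hasSum_re ((E.hasSum_proj t ht hd x).mapL (innerSL ℂ x))
      rw [← h.tsum_eq, ENNReal.ofReal_tsum_of_nonneg (fun n => E.re_inner_nonneg (ht n) x)
        h.summable])

theorem scalarMeasure_apply (x : H) {t : Set ℝ} (ht : MeasurableSet t) :
    E.scalarMeasure x t = ENNReal.ofReal (inner ℂ x (E.proj t x)).re :=
  Measure.ofMeasurable_apply t ht

/-- `E` is the resolution of the identity (spectral measure) of `A`, that is `A = ∫ t dE(t)`: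
the domain of `A` is `{x | ∫ t² d⟨x, E x⟩ < ∞}` and `⟨x, A x⟩ = ∫ t d⟨x, E x⟩` there. As `H` is a
complex space, this quadratic form determines `A` by polarization. -/
def IsResolutionOfIdentity (A : H →ₗ.[ℂ] H) : Prop :=
  (∀ x : H, x ∈ A.domain ↔ Integrable (fun t : ℝ => t ^ 2) (E.scalarMeasure x)) ∧
  ∀ x : A.domain, inner ℂ (x : H) (A x) = ((∫ t : ℝ, t ∂E.scalarMeasure (x : H) : ℝ) : ℂ)

end ProjectionValuedMeasure

/-- `g` is a generating vector of the selfadjoint operator `A` with resolution of the identity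
`E`: the linear span of the vectors `E(Δ) g`, where `Δ` runs over the intervals
`[a, b)`, is dense. -/
def IsGeneratingVector (A : H →ₗ.[ℂ] H) (g : H) : Prop :=
  ∃ E : ProjectionValuedMeasure H, E.IsResolutionOfIdentity A ∧
    Dense (Submodule.span ℂ {v : H | ∃ a b : ℝ, v = E.proj (Set.Ico a b) g} : Set H)

end OperatorTheory

end

/-!
The graph of `S_β` has a description free of the point `w`: it is the relation `T` of all pairs
`(g, h)` for which `h(z) - z g(z) = c s_β(z)` with a constant `c` (`coe_relation`).

*Hilbert space.* For `f` in `B(e)` the functions `f / e` and `f^# / e` are Poisson integrals of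
their boundary values (`IsHardyH2.integral_poisson`). Hence `|f(w)|` is at most a multiple of
`‖f‖ / |Im w|^{1/2}` near the real line, and the maximum principle for `(z² - R²) f(z)`, where
`|z² - R²| = 2R |Im z|` on the circle `|z| = R`, turns this into a locally uniform bound
(`exists_norm_apply_le`). So norm convergence implies locally uniform convergence, and `B(e)` is
complete.

*Self-adjointness.* If `(g, h)` and `(g', h')` are in `T` with constants `c` and `c'`, then
`⟨h, g'⟩ - ⟨g, h'⟩` is the integral of `s_β u / |e|²` with `u = conj c • g' - c' • g^#`, and
`z u(z)` lies in `B(e)` again. On the real line `s_β / |e|² = (i/2) (e^{iβ} / e^# - e^{-iβ} / e)`, and by the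
Poisson formula at `iy`, `y → ∞`, the integral depends only on the limits of `y (u / e)(iy)` and
`y (u^# / e)(iy)` (`integral_s_mul_eq`), which are zero. So `T` is symmetric. Division by `z - w`
shows that `T - w` is onto for nonreal `w` (`exists_resolvent`), and `T` is self-adjoint. The same
integral formula, now with `s_0` in place of `s_β`, gives `⟨s_0, g⟩ = -π c sin β` for `(g, h)` in
`T` (`inner_s_zero`). It follows that `T` is the graph of an operator, that its eigenspaces are
one-dimensional, and that no eigenvector is orthogonal to `s_0`.

*Spectral resolution.* No general spectral theorem is needed, as the eigenvectors are total
(`eq_zero_of_orthogonal_eigenvectors`). Let `f` be orthogonal to all of them. The constant `c`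
belonging to `(S_β - w)⁻¹ f` is `f(w) / s_β(w)`, so this meromorphic function of `w` is bounded by a
multiple of `‖(S_β - w)⁻¹ f‖`. The latter is `O(1 / |Im w|)`, and `o(1 / y)` at `w = t + iy`,
`y → 0`, because `f` is orthogonal to the kernel of `S_β - t`. Hence `f / s_β` has no poles, is
`O(1 / |Im w|)`, and vanishes. The resolution of the identity is then the one of an orthonormal
basis of eigenvectors, and `s_0` is generating because all its coordinates in this basis are
nonzero and the eigenvalues are distinct.
-/

/-! ### Pointwise bounds for Hardy space functions -/

/-- The mean value property, applied to the holomorphic function `F²`. -/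
theorem enorm_sq_le_lintegral_circle {F : ℂ → ℂ} {z : ℂ} {r : ℝ}
    (hF : DiffContOnCl ℂ F (Metric.ball z |r|)) :
    ENNReal.ofReal (2 * Real.pi) * ‖F z‖ₑ ^ 2 ≤
      ∫⁻ θ in Set.Ioo (-Real.pi) Real.pi, ‖F (z + Complex.polarCoord.symm (r, θ))‖ₑ ^ 2 := by
  have h1 := (hF.smul hF).circleAverage
  have h2 : (∫ θ in (-Real.pi)..Real.pi,
      (F • F) (z + Complex.polarCoord.symm (r, θ))) = (2 * Real.pi) • (F z) ^ 2 := by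
    rw [Real.circleAverage_eq_integral_add (-Real.pi)] at h1
    change (2 * Real.pi)⁻¹ • ∫ θ in 0..2 * Real.pi, (F • F) (circleMap z r (θ + -Real.pi)) =
      F z * F z at h1
    have h3 := intervalIntegral.integral_comp_add_right (a := 0) (b := 2 * Real.pi)
      (fun θ => (F • F) (circleMap z r θ)) (-Real.pi)
    rw [h3] at h1
    have h4 : 2 * Real.pi + -Real.pi = Real.pi := by ring
    rw [zero_add, h4, inv_smul_eq_iff₀ (by positivity)] at h1
    rw [sq]
    refine Eq.trans (intervalIntegral.integral_congr fun θ _ => ?_) h1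
    simp only [circleMap, Complex.polarCoord_symm_apply, Complex.exp_mul_I, Complex.ofReal_cos,
      Complex.ofReal_sin]
  have h5 : ‖(2 * Real.pi) • (F z) ^ 2‖ₑ = ENNReal.ofReal (2 * Real.pi) * ‖F z‖ₑ ^ 2 := by
    rw [enorm_smul, enorm_pow, Real.enorm_of_nonneg (by positivity)]
  rw [← h5, ← h2, intervalIntegral.integral_of_le (by linarith [Real.pi_pos]),
    integral_Ioc_eq_integral_Ioo]
  refine (enorm_integral_le_lintegral_enorm _).trans (lintegral_mono fun θ => ?_)
  simp [sq, enorm_mul]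

/-- A Hardy space function is bounded on each half-plane `Im z ≥ ε`: by the mean value property,
`|F(z)|²` is at most the mean of `|F|²` over a disc, hence over a strip. -/
theorem IsHardyH2.exists_bound {F : ℂ → ℂ} (hF : IsHardyH2 F) {ε : ℝ} (hε : 0 < ε) :
    ∃ M : ℝ, ∀ z : ℂ, ε ≤ z.im → ‖F z‖ ≤ M := by
  set C := ⨆ (y : ℝ) (_ : 0 < y), ∫⁻ x : ℝ, ‖F ((x : ℂ) + (y : ℂ) * Complex.I)‖ₑ ^ 2 with hC
  have hCtop : C < ∞ := hF.2
  set U : Set ℂ := {z : ℂ | 0 < z.im} with hU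
  have hUo : IsOpen U := isOpen_lt continuous_const Complex.continuous_im
  set ρ := ε / 2 with hρ
  have hρ0 : 0 < ρ := by positivity
  set A : ℝ≥0∞ := ENNReal.ofReal (2 * Real.pi) * ∫⁻ r in Set.Ioo 0 ρ, ENNReal.ofReal r with hA
  have hA0 : A ≠ 0 := by
    refine mul_ne_zero (by simp [Real.pi_pos]) ?_
    rw [← pos_iff_ne_zero, setLIntegral_pos_iff (by fun_prop)]
    have : Set.Ioo 0 ρ ⊆ Function.support (fun r : ℝ => ENNReal.ofReal r) ∩ Set.Ioo 0 ρ :=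
      fun r hr => ⟨by simpa using hr.1, hr⟩
    refine lt_of_lt_of_le ?_ (measure_mono this)
    simpa using hρ0
  -- Integrate the circle means over the radii in `(0, ρ)`. The function `F` is arbitrary on the
  -- lower half-plane, so it is cut off there to be measurable.
  have key : ∀ z : ℂ, ε ≤ z.im → A * ‖F z‖ₑ ^ 2 ≤ ENNReal.ofReal (2 * ρ) * C := by
    intro z hz
    set S : Set ℂ := {u : ℂ | u.im ∈ Set.Ioo (-ρ) ρ} with hS
    have hSo : IsOpen S := isOpen_Ioo.preimage Complex.continuous_im
    classical
    set F' : ℂ → ℂ := U.piecewise F 0 with hF'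
    have hF'm : Measurable F' :=
      hF.1.continuousOn.measurable_piecewise continuous_zero.continuousOn hUo.measurableSet
    set f : ℂ → ℝ≥0∞ := S.indicator fun u => ‖F' (z + u)‖ₑ ^ 2 with hf
    have hSU : ∀ u ∈ S, z + u ∈ U := by
      intro u hu
      have := hu.1
      simp only [hU, Set.mem_ofPred_eq, Complex.add_im]
      linarith
    have hfF : ∀ u ∈ S, f u = ‖F (z + u)‖ₑ ^ 2 := by
      intro u hu
      rw [hf, Set.indicator_of_mem hu, hF', Set.piecewise_eq_of_mem _ _ _ (hSU u hu)]
    have hfm : Measurable f :=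
      ((hF'm.comp (measurable_const.add measurable_id)).enorm.pow_const 2).indicator
        hSo.measurableSet
    have h1 : ∫⁻ u, f u ≤ ENNReal.ofReal (2 * ρ) * C := by
      rw [← (Complex.volume_preserving_equiv_real_prod.symm).lintegral_comp hfm,
        Measure.volume_eq_prod, lintegral_prod_symm' _ (by fun_prop)]
      calc ∫⁻ v : ℝ, ∫⁻ x : ℝ, f (Complex.measurableEquivRealProd.symm (x, v))
          ≤ ∫⁻ v : ℝ, (Set.Ioo (-ρ) ρ).indicator (fun _ => C) v := by
            refine lintegral_mono fun v => ?_
            have e1 : ∀ x : ℝ, Complex.measurableEquivRealProd.symm (x, v) =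
                x + v * Complex.I := fun x => by
              apply Complex.ext <;> simp [Complex.measurableEquivRealProd_symm_apply]
            by_cases hv : v ∈ Set.Ioo (-ρ) ρ
            · rw [Set.indicator_of_mem hv]
              have hmem : ∀ x : ℝ, (x : ℂ) + v * Complex.I ∈ S := fun x => by simpa [hS] using hv
              have h2 : ∀ x : ℝ, f (Complex.measurableEquivRealProd.symm (x, v)) =
                  ‖F (((x + z.re : ℝ) : ℂ) + ((z.im + v : ℝ) : ℂ) * Complex.I)‖ₑ ^ 2 := by
                intro x
                rw [e1, hfF _ (hmem x)]
                congr 3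
                apply Complex.ext <;> simp [add_comm]
              simp only [h2]
              rw [lintegral_add_right_eq_self
                (fun x : ℝ => ‖F ((x : ℂ) + ((z.im + v : ℝ) : ℂ) * Complex.I)‖ₑ ^ 2) z.re]
              have hpos : 0 < z.im + v := by linarith [hv.1]
              exact le_iSup₂ (f := fun (y : ℝ) (_ : 0 < y) =>
                ∫⁻ x : ℝ, ‖F ((x : ℂ) + (y : ℂ) * Complex.I)‖ₑ ^ 2) _ hpos
            · have h2 : ∀ x : ℝ, f (Complex.measurableEquivRealProd.symm (x, v)) = 0 := by
                intro x
                rw [e1, hf, Set.indicator_of_notMem]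
                simpa [hS] using hv
              rw [lintegral_congr h2]
              simp
        _ = ENNReal.ofReal (2 * ρ) * C := by
            rw [lintegral_indicator measurableSet_Ioo, setLIntegral_const, Real.volume_Ioo,
              mul_comm]
            ring_nf
    refine le_trans ?_ h1
    rw [← Complex.lintegral_comp_polarCoord_symm]
    calc A * ‖F z‖ₑ ^ 2
        = ∫⁻ r in Set.Ioo 0 ρ, ENNReal.ofReal r * (ENNReal.ofReal (2 * Real.pi) * ‖F z‖ₑ ^ 2) := by
          rw [lintegral_mul_const _ (by fun_prop), hA]
          ring
      _ ≤ ∫⁻ r in Set.Ioo 0 ρ, ∫⁻ θ in Set.Ioo (-Real.pi) Real.pi,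
            ENNReal.ofReal r • f (Complex.polarCoord.symm (r, θ)) := by
          refine setLIntegral_mono' measurableSet_Ioo fun r hr => ?_
          have hS' : ∀ u : ℂ, ‖u‖ ≤ r → u ∈ S := by
            intro u hu
            have := abs_le.1 (u.abs_im_le_norm.trans hu)
            exact ⟨by linarith [this.1, hr.2], by linarith [this.2, hr.2]⟩
          have hd : DiffContOnCl ℂ F (Metric.ball z |r|) := by
            refine (hF.1.mono fun u hu => ?_).diffContOnCl
            rw [abs_of_pos hr.1] at hu
            have h3 := Metric.closure_ball_subset_closedBall hu
            rw [mem_closedBall_iff_norm] at h3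
            have h4 := hSU _ (hS' _ h3)
            rwa [add_sub_cancel] at h4
          simp only [smul_eq_mul]
          rw [lintegral_const_mul' _ _ ENNReal.ofReal_ne_top]
          gcongr
          refine (enorm_sq_le_lintegral_circle hd).trans (lintegral_mono fun θ => ?_)
          rw [hfF _ (hS' _ (by rw [Complex.norm_polarCoord_symm, abs_of_pos hr.1]))]
      _ = ∫⁻ p in Set.Ioo 0 ρ ×ˢ Set.Ioo (-Real.pi) Real.pi,
            ENNReal.ofReal p.1 • f (Complex.polarCoord.symm p) := by
          rw [Measure.volume_eq_prod, setLIntegral_prod]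
          refine Measurable.aemeasurable ?_
          have : Measurable fun p : ℝ × ℝ => Complex.polarCoord.symm p := by
            simp only [Complex.polarCoord_symm_apply]
            fun_prop
          exact (measurable_fst.ennreal_ofReal).mul (hfm.comp this)
      _ ≤ _ := lintegral_mono_set (Set.prod_mono Set.Ioo_subset_Ioi_self subset_rfl)
  have hB : ENNReal.ofReal (2 * ρ) * C / A < ∞ :=
    ENNReal.div_lt_top (ENNReal.mul_lt_top ENNReal.ofReal_lt_top hCtop).ne hA0
  refine ⟨Real.sqrt (ENNReal.ofReal (2 * ρ) * C / A).toReal, fun z hz => ?_⟩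
  have hAtop : A ≠ ∞ := by
    refine ENNReal.mul_ne_top ENNReal.ofReal_ne_top (ne_top_of_le_ne_top ?_
      (setLIntegral_mono' (g := fun _ => ENNReal.ofReal ρ) measurableSet_Ioo
        fun r hr => ENNReal.ofReal_le_ofReal hr.2.le))
    simp [ENNReal.mul_eq_top]
  have h2 : ‖F z‖ₑ ^ 2 ≤ ENNReal.ofReal (2 * ρ) * C / A := by
    rw [ENNReal.le_div_iff_mul_le (Or.inl hA0) (Or.inl hAtop), mul_comm]
    exact key z hz
  refine Real.le_sqrt_of_sq_le ?_
  have := ENNReal.toReal_mono hB.ne h2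
  simpa using this

/-! ### The Poisson formula -/

theorem norm_ofReal_sub_sq (x : ℝ) (w : ℂ) : ‖(x : ℂ) - w‖ ^ 2 = (x - w.re) ^ 2 + w.im ^ 2 := by
  rw [← Complex.normSq_eq_norm_sq, Complex.normSq_apply]
  simp
  ring

theorem norm_ofReal_sub_pos (x : ℝ) {w : ℂ} (hw : 0 < w.im) : 0 < ‖(x : ℂ) - w‖ ^ 2 := by
  rw [norm_ofReal_sub_sq]
  positivity

theorem inv_norm_sq_eq_cauchyPDFReal {w : ℂ} (hw : 0 < w.im) (x : ℝ) :
    (‖(x : ℂ) - w‖ ^ 2)⁻¹ =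
      Real.pi / w.im * ProbabilityTheory.cauchyPDFReal w.re w.im.toNNReal x := by
  rw [ProbabilityTheory.cauchyPDFReal_def, norm_ofReal_sub_sq]
  have := Real.pi_ne_zero
  rw [Real.coe_toNNReal _ hw.le]
  field_simp

theorem integrable_inv_norm_sq {w : ℂ} (hw : 0 < w.im) :
    Integrable fun x : ℝ => (‖(x : ℂ) - w‖ ^ 2)⁻¹ := by
  simp only [inv_norm_sq_eq_cauchyPDFReal hw]
  exact (ProbabilityTheory.integrable_cauchyPDFReal _).const_mul _

theorem integral_inv_norm_sq {w : ℂ} (hw : 0 < w.im) :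
    ∫ x : ℝ, (‖(x : ℂ) - w‖ ^ 2)⁻¹ = Real.pi / w.im := by
  simp only [inv_norm_sq_eq_cauchyPDFReal hw]
  rw [integral_const_mul, ProbabilityTheory.integral_cauchyPDFReal_eq_one _
    (by simpa using hw), mul_one]

theorem mul_conj_sub_eq (x : ℝ) (w : ℂ) :
    ((x : ℂ) - w) * (x - conj w) = ((‖(x : ℂ) - w‖ ^ 2 : ℝ) : ℂ) := by
  rw [← Complex.normSq_eq_norm_sq, ← Complex.mul_conj]
  simp

/-- A function holomorphic past the closed upper half-plane and `O(|z|⁻²)` on it has vanishing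
integral over the real line. -/
theorem integral_eq_zero_of_decay {G : ℂ → ℂ} (hG : DifferentiableOn ℂ G {z | 0 ≤ z.im})
    (hint : Integrable fun x : ℝ => G x) {K R₀ : ℝ}
    (hK : ∀ z : ℂ, 0 ≤ z.im → R₀ ≤ ‖z‖ → ‖G z‖ ≤ K / ‖z‖ ^ 2) :
    ∫ x : ℝ, G x = 0 := by
  have h1 : Tendsto (fun R : ℝ => ∫ x in (-R)..R, G x) atTop (𝓝 (∫ x : ℝ, G x)) :=
    intervalIntegral_tendsto_integral hint tendsto_neg_atTop_atBot tendsto_id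
  refine tendsto_nhds_unique h1 ?_
  have h2 : Tendsto (fun R : ℝ => 4 * |K| / R) atTop (𝓝 0) :=
    tendsto_const_nhds.div_atTop tendsto_id
  refine squeeze_zero_norm' ?_ h2
  filter_upwards [eventually_gt_atTop 0, eventually_ge_atTop R₀] with R hR hR0
  have hrect := Complex.integral_boundary_rect_eq_zero_of_differentiableOn G (-R : ℝ)
    (R + R * Complex.I)
    (hG.mono fun z hz => by
      have h3 := hz.2
      simp only [Complex.ofReal_im, Complex.add_im, Complex.mul_im, Complex.ofReal_re, Complex.I_im,
        mul_one, Complex.I_re, mul_zero, add_zero, zero_add] at h3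
      rw [Set.mem_preimage, Set.uIcc_of_le hR.le] at h3
      exact h3.1)
  simp only [Complex.ofReal_im, Complex.add_im, Complex.mul_im, Complex.ofReal_re, Complex.I_im,
    mul_one, Complex.I_re, mul_zero, add_zero, zero_add, Complex.add_re, Complex.mul_re,
    Complex.ofReal_zero, zero_mul, sub_self, smul_eq_mul] at hrect
  have hb : ∀ z : ℂ, 0 ≤ z.im → R ≤ ‖z‖ → ‖G z‖ ≤ |K| / R ^ 2 := by
    intro z hz hzR
    refine (hK z hz (hR0.trans hzR)).trans ?_
    gcongr
    exact le_abs_self K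
  have ht : ‖∫ x in (-R)..R, G (x + R * Complex.I)‖ ≤ |K| / R ^ 2 * |R - -R| := by
    refine intervalIntegral.norm_integral_le_of_norm_le_const fun x _ =>
      hb _ (by simpa using hR.le) ?_
    refine le_trans ?_ (Complex.abs_im_le_norm _)
    simp [abs_of_pos hR]
  have hr : ‖∫ y in (0:ℝ)..R, G (R + y * Complex.I)‖ ≤ |K| / R ^ 2 * |R - 0| := by
    refine intervalIntegral.norm_integral_le_of_norm_le_const fun y hy => hb _ ?_ ?_
    · rw [Set.uIoc_of_le hR.le] at hy
      simpa using hy.1.le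
    refine le_trans ?_ (Complex.abs_re_le_norm _)
    simp [abs_of_pos hR]
  have hl : ‖∫ y in (0:ℝ)..R, G ((-R : ℝ) + y * Complex.I)‖ ≤ |K| / R ^ 2 * |R - 0| := by
    refine intervalIntegral.norm_integral_le_of_norm_le_const fun y hy => hb _ ?_ ?_
    · rw [Set.uIoc_of_le hR.le] at hy
      simpa using hy.1.le
    refine le_trans ?_ (Complex.abs_re_le_norm _)
    simp [abs_of_pos hR]
  have e1 : ∫ x in (-R)..R, G x = (∫ x in (-R)..R, G (x + R * Complex.I)) -
      Complex.I * (∫ y in (0:ℝ)..R, G (R + y * Complex.I)) +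
      Complex.I * ∫ y in (0:ℝ)..R, G ((-R : ℝ) + y * Complex.I) := by
    linear_combination hrect
  rw [e1]
  refine (norm_add_le _ _).trans ((add_le_add_left (norm_sub_le _ _) _).trans ?_)
  rw [norm_mul, norm_mul, Complex.norm_I, one_mul, one_mul]
  refine (add_le_add (add_le_add ht hr) hl).trans (le_of_eq ?_)
  have h5 : 0 < R - -R := by linarith
  rw [sub_zero, abs_of_pos hR, abs_of_pos h5]
  field_simp
  ring

/-- The Poisson formula for a bounded function holomorphic past the closed upper half-plane: the
function `(G(z) - G(w)) / ((z - w) (z - conj w))` is holomorphic and `O(|z|⁻²)`, so its integral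
over the real line is zero. -/
theorem integral_poisson_of_bounded {G : ℂ → ℂ} {ε M : ℝ} (hε : 0 < ε)
    (hG : DifferentiableOn ℂ G {z | -ε < z.im}) (hM : ∀ z : ℂ, 0 ≤ z.im → ‖G z‖ ≤ M)
    {w : ℂ} (hw : 0 < w.im) :
    ∫ x : ℝ, G x * ((‖(x : ℂ) - w‖ ^ 2)⁻¹ : ℝ) = Real.pi / w.im * G w := by
  have hM0 : 0 ≤ M := (norm_nonneg _).trans (hM w hw.le)
  set U : Set ℂ := {z | -ε < z.im} with hU
  have hUo : IsOpen U := isOpen_lt continuous_const Complex.continuous_im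
  have hcont : Continuous fun x : ℝ => G x :=
    hG.continuousOn.comp_continuous Complex.continuous_ofReal (by simpa [hU] using hε)
  have hi1 : Integrable fun x : ℝ => G x * ((‖(x : ℂ) - w‖ ^ 2)⁻¹ : ℝ) :=
    (integrable_inv_norm_sq hw).ofReal.bdd_mul hcont.aestronglyMeasurable
      (Eventually.of_forall fun x => hM x (by simp))
  have hi2 : Integrable fun x : ℝ => G w * ((‖(x : ℂ) - w‖ ^ 2)⁻¹ : ℝ) :=
    (integrable_inv_norm_sq hw).ofReal.const_mul _
  set Φ : ℂ → ℂ := fun z => dslope G w z / (z - conj w) with hΦ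
  have hne : ∀ z : ℂ, 0 ≤ z.im → z - conj w ≠ 0 := by
    intro z hz h
    have := congrArg Complex.im h
    simp at this
    linarith
  have hΦd : DifferentiableOn ℂ Φ {z | 0 ≤ z.im} := by
    refine DifferentiableOn.div (DifferentiableOn.mono (((Complex.differentiableOn_dslope
      (hUo.mem_nhds ?_)).2 hG)) fun z hz => ?_) (by fun_prop) fun z hz => hne z hz
    · have : -ε < w.im := by linarith
      simpa [hU] using this
    · have h1 : 0 ≤ z.im := hz
      have : -ε < z.im := by linarith
      simpa [hU] using this
  have hΦx : ∀ x : ℝ, Φ x = G x * ((‖(x : ℂ) - w‖ ^ 2)⁻¹ : ℝ) -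
      G w * ((‖(x : ℂ) - w‖ ^ 2)⁻¹ : ℝ) := by
    intro x
    have hxw : (x : ℂ) ≠ w := by
      rintro rfl
      simp at hw
    rw [hΦ]
    simp only
    rw [dslope_of_ne _ hxw, slope_def_field, div_div, mul_conj_sub_eq, ← sub_mul, div_eq_mul_inv,
      Complex.ofReal_inv]
  have h0 : ∫ x : ℝ, Φ x = 0 := by
    refine integral_eq_zero_of_decay (K := 8 * M) (R₀ := 2 * ‖w‖) hΦd ?_ ?_
    · simp only [hΦx]
      exact hi1.sub hi2
    · intro z hz hzw
      have hw0 : 0 < ‖w‖ := norm_pos_iff.2 (by rintro rfl; simp at hw)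
      have hz0 : 0 < ‖z‖ := by linarith
      have hzw' : z ≠ w := by
        rintro rfl
        linarith
      rw [hΦ]
      simp only
      rw [dslope_of_ne _ hzw', slope_def_field, div_div, norm_div, norm_mul]
      have h1 : ‖z‖ / 2 ≤ ‖z - w‖ := by linarith [norm_sub_norm_le z w]
      have h2 : ‖z‖ / 2 ≤ ‖z - conj w‖ := by
        have := norm_sub_norm_le z (conj w)
        rw [RCLike.norm_conj] at this
        linarith
      have h3 : ‖G z - G w‖ ≤ 2 * M := (norm_sub_le _ _).trans (by linarith [hM z hz, hM w hw.le])
      calc ‖G z - G w‖ / (‖z - w‖ * ‖z - conj w‖) ≤ 2 * M / (‖z‖ / 2 * (‖z‖ / 2)) := by gcongr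
        _ = 8 * M / ‖z‖ ^ 2 := by field_simp; ring
  simp only [hΦx] at h0
  rw [integral_sub hi1 hi2, sub_eq_zero] at h0
  rw [h0, integral_const_mul, integral_complex_ofReal, integral_inv_norm_sq hw]
  push_cast
  ring

/-! ### Boundary values of Hardy space functions -/

/-- Bounded sequences in `L²` converging almost everywhere converge weakly. -/
theorem tendsto_integral_mul_of_ae {α : Type*} [MeasurableSpace α] {μ : Measure α}
    {φ : ℕ → α → ℂ} {φ₀ k : α → ℂ} {C : ℝ}
    (hφ : ∀ n, MemLp (φ n) 2 μ) (hC : ∀ n, ∫ x, ‖φ n x‖ ^ 2 ∂μ ≤ C) (hφ₀ : MemLp φ₀ 2 μ)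
    (hk : MemLp k 2 μ) (hae : ∀ᵐ x ∂μ, Tendsto (fun n => φ n x) atTop (𝓝 (φ₀ x))) :
    Tendsto (fun n => ∫ x, φ n x * k x ∂μ) atTop (𝓝 (∫ x, φ₀ x * k x ∂μ)) := by
  have hsq : ∀ {ψ : α → ℂ}, MemLp ψ 2 μ → Integrable (fun x => ‖ψ x‖ ^ 2) μ :=
    fun h => (memLp_two_iff_integrable_sq_norm h.1).1 h
  set D := 2 * C + 2 * ∫ x, ‖φ₀ x‖ ^ 2 ∂μ with hD
  have hd : ∀ n, MemLp (fun x => φ n x - φ₀ x) 2 μ := fun n => (hφ n).sub hφ₀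
  have hdD : ∀ n, ∫ x, ‖φ n x - φ₀ x‖ ^ 2 ∂μ ≤ D := by
    intro n
    calc ∫ x, ‖φ n x - φ₀ x‖ ^ 2 ∂μ ≤ ∫ x, (2 * ‖φ n x‖ ^ 2 + 2 * ‖φ₀ x‖ ^ 2) ∂μ := by
          refine integral_mono (hsq (hd n)) (((hsq (hφ n)).const_mul 2).add
            ((hsq hφ₀).const_mul 2)) fun x => ?_
          have h1 := norm_sub_le (φ n x) (φ₀ x)
          have h2 : ‖φ n x - φ₀ x‖ ^ 2 ≤ (‖φ n x‖ + ‖φ₀ x‖) ^ 2 := by gcongr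
          simp only
          nlinarith [sq_nonneg (‖φ n x‖ - ‖φ₀ x‖)]
      _ ≤ D := by
          rw [integral_add ((hsq (hφ n)).const_mul 2) ((hsq hφ₀).const_mul 2),
            integral_const_mul, integral_const_mul, hD]
          linarith [hC n]
  have hD0 : 0 ≤ D := (integral_nonneg fun x => by positivity).trans (hdD 0)
  have hint : ∀ {ψ : α → ℂ}, MemLp ψ 2 μ → Integrable (fun x => ψ x * k x) μ :=
    fun h => h.integrable_mul hk
  rw [Metric.tendsto_atTop]
  intro η hη
  -- `D` bounds the integrals of `‖φ n - φ₀‖²`, so these contribute at most `δ D ≤ η / 2`.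
  set δ := η / (2 * (D + 1)) with hδ
  have hδ0 : 0 < δ := by positivity
  -- The part of the product `‖φ n - φ₀‖ ‖k‖` not controlled by `δ ‖φ n - φ₀‖²` is dominated.
  set g : ℕ → α → ℝ := fun n x => min (‖φ n x - φ₀ x‖ * ‖k x‖) (‖k x‖ ^ 2 / δ) with hg
  have hgm : ∀ n, AEStronglyMeasurable (g n) μ := fun n =>
    ((hd n).1.norm.mul hk.1.norm).inf ((hsq hk).div_const δ).1
  have hgb : ∀ n x, ‖g n x‖ ≤ ‖k x‖ ^ 2 / δ := by
    intro n x
    rw [Real.norm_of_nonneg (le_min (by positivity) (by positivity))]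
    exact min_le_right _ _
  have hg0 : Tendsto (fun n => ∫ x, g n x ∂μ) atTop (𝓝 (∫ _, (0 : ℝ) ∂μ)) := by
    refine tendsto_integral_of_dominated_convergence (fun x => ‖k x‖ ^ 2 / δ) hgm
      ((hsq hk).div_const δ) (fun n => Eventually.of_forall (hgb n)) ?_
    filter_upwards [hae] with x hx
    have h1 : Tendsto (fun n => ‖φ n x - φ₀ x‖ * ‖k x‖) atTop (𝓝 0) := by
      have := ((hx.sub_const (φ₀ x)).norm).mul_const ‖k x‖
      simpa using this
    have h2 := h1.min (tendsto_const_nhds (x := ‖k x‖ ^ 2 / δ))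
    rwa [min_eq_left (by positivity)] at h2
  rw [integral_zero, Metric.tendsto_atTop] at hg0
  obtain ⟨N, hN⟩ := hg0 (η / 2) (by positivity)
  refine ⟨N, fun n hn => ?_⟩
  have hgi : Integrable (g n) μ := ((hsq hk).div_const δ).mono' (hgm n)
    (Eventually.of_forall (hgb n))
  rw [dist_eq_norm, ← integral_sub (hint (hφ n)) (hint hφ₀)]
  calc ‖∫ x, (φ n x * k x - φ₀ x * k x) ∂μ‖
      ≤ ∫ x, (δ * ‖φ n x - φ₀ x‖ ^ 2 + g n x) ∂μ := by
        refine norm_integral_le_of_norm_le (((hsq (hd n)).const_mul δ).add hgi)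
          (Eventually.of_forall fun x => ?_)
        rw [← sub_mul, norm_mul]
        simp only [hg]
        rcases le_total ‖φ n x - φ₀ x‖ (‖k x‖ / δ) with h | h
        · have h1 : ‖φ n x - φ₀ x‖ * ‖k x‖ ≤ ‖k x‖ ^ 2 / δ := by
            calc _ ≤ ‖k x‖ / δ * ‖k x‖ := by gcongr
              _ = _ := by ring
          rw [min_eq_left h1]
          linarith [mul_nonneg hδ0.le (sq_nonneg ‖φ n x - φ₀ x‖)]
        · have h1 : ‖k x‖ ≤ δ * ‖φ n x - φ₀ x‖ := by
            rw [div_le_iff₀ hδ0] at h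
            linarith
          have h2 : ‖φ n x - φ₀ x‖ * ‖k x‖ ≤ δ * ‖φ n x - φ₀ x‖ ^ 2 := by
            calc _ ≤ ‖φ n x - φ₀ x‖ * (δ * ‖φ n x - φ₀ x‖) := by gcongr
              _ = _ := by ring
          have h3 : 0 ≤ min (‖φ n x - φ₀ x‖ * ‖k x‖) (‖k x‖ ^ 2 / δ) :=
            le_min (by positivity) (by positivity)
          linarith
    _ = δ * (∫ x, ‖φ n x - φ₀ x‖ ^ 2 ∂μ) + ∫ x, g n x ∂μ := by
        rw [integral_add ((hsq (hd n)).const_mul δ) hgi, integral_const_mul]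
    _ < η := by
        have h1 := hN n hn
        rw [dist_zero_right] at h1
        have h2 := (le_abs_self _).trans_lt h1
        have h3 : δ * (∫ x, ‖φ n x - φ₀ x‖ ^ 2 ∂μ) ≤ δ * D := by gcongr; exact hdD n
        have h4 : δ * D ≤ η / 2 := by
          calc δ * D ≤ δ * (D + 1) := by gcongr; linarith
            _ = η / 2 := by rw [hδ]; field_simp
        linarith

theorem continuous_inv_norm_sq {w : ℂ} (hw : 0 < w.im) :
    Continuous fun x : ℝ => (‖(x : ℂ) - w‖ ^ 2)⁻¹ :=
  Continuous.inv₀ (by fun_prop) fun x => (norm_ofReal_sub_pos x hw).ne'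

theorem inv_norm_sq_le {w : ℂ} (hw : 0 < w.im) (x : ℝ) :
    (‖(x : ℂ) - w‖ ^ 2)⁻¹ ≤ (w.im ^ 2)⁻¹ := by
  rw [norm_ofReal_sub_sq]
  gcongr
  linarith [sq_nonneg (x - w.re)]

theorem memLp_inv_norm_sq {w : ℂ} (hw : 0 < w.im) :
    MemLp (fun x : ℝ => (((‖(x : ℂ) - w‖ ^ 2)⁻¹ : ℝ) : ℂ)) 2 := by
  have hc : Continuous fun x : ℝ => (((‖(x : ℂ) - w‖ ^ 2)⁻¹ : ℝ) : ℂ) :=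
    Complex.continuous_ofReal.comp (continuous_inv_norm_sq hw)
  rw [memLp_two_iff_integrable_sq_norm hc.aestronglyMeasurable]
  refine ((integrable_inv_norm_sq hw).const_mul ((w.im ^ 2)⁻¹)).mono'
    (hc.norm.pow 2).aestronglyMeasurable (Eventually.of_forall fun x => ?_)
  have h0 : 0 ≤ (‖(x : ℂ) - w‖ ^ 2)⁻¹ := by positivity
  rw [Complex.norm_real, Real.norm_of_nonneg h0, Real.norm_of_nonneg (by positivity), sq]
  exact mul_le_mul_of_nonneg_right (inv_norm_sq_le hw x) h0

theorem IsHardyH2.memLp_line {F : ℂ → ℂ} (hF : IsHardyH2 F) {y : ℝ} (hy : 0 < y) :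
    MemLp (fun x : ℝ => F ((x : ℂ) + (y : ℂ) * Complex.I)) 2 := by
  refine ⟨(hF.continuous_line hy).aestronglyMeasurable, ?_⟩
  rw [eLpNorm_lt_top_iff_lintegral_rpow_enorm_lt_top (by norm_num) (by norm_num)]
  refine lt_of_le_of_lt ?_ hF.2
  refine le_trans (le_of_eq ?_) (le_iSup₂ (f := fun (y : ℝ) (_ : 0 < y) =>
    ∫⁻ x : ℝ, ‖F ((x : ℂ) + (y : ℂ) * Complex.I)‖ₑ ^ 2) y hy)
  simp

theorem lintegral_enorm_sq_eq {φ : ℝ → ℂ} (hφ : MemLp φ 2) :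
    ∫⁻ x, ‖φ x‖ₑ ^ 2 = ENNReal.ofReal (∫ x, ‖φ x‖ ^ 2) := by
  rw [ofReal_integral_eq_lintegral_ofReal ((memLp_two_iff_integrable_sq_norm hφ.1).1 hφ)
    (Eventually.of_forall fun x => by positivity)]
  refine lintegral_congr fun x => ?_
  rw [ENNReal.ofReal_pow (norm_nonneg _), ofReal_norm]

/-- The Poisson formula for the boundary values of a Hardy space function. -/
theorem IsHardyH2.integral_poisson {F : ℂ → ℂ} (hF : IsHardyH2 F) {φ : ℝ → ℂ} (hφ : MemLp φ 2)
    (hlim : ∀ᵐ x : ℝ, Tendsto (fun y : ℝ => F ((x : ℂ) + (y : ℂ) * Complex.I)) (𝓝[>] 0) (𝓝 (φ x)))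
    {w : ℂ} (hw : 0 < w.im) :
    ∫ x : ℝ, φ x * ((‖(x : ℂ) - w‖ ^ 2)⁻¹ : ℝ) = Real.pi / w.im * F w := by
  set u : ℕ → ℝ := fun n => 1 / ((n : ℝ) + 1) with hu
  have hupos : ∀ n, 0 < u n := fun n => by positivity
  have hu0 : Tendsto u atTop (𝓝[>] 0) := tendsto_nhdsWithin_iff.2
    ⟨tendsto_one_div_add_atTop_nhds_zero_nat, Eventually.of_forall hupos⟩
  have h1 : Tendsto (fun n => ∫ x : ℝ, F ((x : ℂ) + (u n : ℂ) * Complex.I) *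
      ((‖(x : ℂ) - w‖ ^ 2)⁻¹ : ℝ)) atTop (𝓝 (∫ x : ℝ, φ x * ((‖(x : ℂ) - w‖ ^ 2)⁻¹ : ℝ))) := by
    refine tendsto_integral_mul_of_ae (C := (⨆ (y : ℝ) (_ : 0 < y),
      ∫⁻ x : ℝ, ‖F ((x : ℂ) + (y : ℂ) * Complex.I)‖ₑ ^ 2).toReal)
      (fun n => hF.memLp_line (hupos n)) (fun n => ?_) hφ (memLp_inv_norm_sq hw) ?_
    · have h2 := lintegral_enorm_sq_eq (hF.memLp_line (hupos n))
      have h3 := le_iSup₂ (f := fun (y : ℝ) (_ : 0 < y) =>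
        ∫⁻ x : ℝ, ‖F ((x : ℂ) + (y : ℂ) * Complex.I)‖ₑ ^ 2) (u n) (hupos n)
      rw [h2] at h3
      exact (ENNReal.ofReal_le_iff_le_toReal hF.2.ne).1 h3
    · filter_upwards [hlim] with x hx
      exact hx.comp hu0
  have h2 : Tendsto (fun n => Real.pi / w.im * F (w + u n * Complex.I)) atTop
      (𝓝 (Real.pi / w.im * F w)) := by
    refine Tendsto.const_mul _ ?_
    have h3 : ContinuousAt F w := (hF.1.differentiableAt ((isOpen_lt continuous_const
      Complex.continuous_im).mem_nhds (by simpa using hw))).continuousAt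
    refine h3.tendsto.comp ?_
    have : Continuous fun y : ℝ => w + (y : ℂ) * Complex.I := by fun_prop
    exact (this.tendsto' 0 w (by simp)).comp (hu0.mono_right nhdsWithin_le_nhds)
  refine tendsto_nhds_unique h1 (h2.congr fun n => ?_)
  obtain ⟨M, hM⟩ := hF.exists_bound (hupos n)
  symm
  refine integral_poisson_of_bounded (G := fun z => F (z + u n * Complex.I)) (hupos n)
    (hF.1.comp (by fun_prop) fun z hz => ?_) (fun z hz => hM _ ?_) hw
  · have h3 : -(u n) < z.im := hz
    have : 0 < z.im + u n := by linarith
    simpa using this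
  · simpa using hz

/-- The value of a Hardy space function at `w`, estimated by the Poisson mean of its boundary
values. -/
theorem IsHardyH2.norm_sq_le_integral {F : ℂ → ℂ} (hF : IsHardyH2 F) {φ : ℝ → ℂ} (hφ : MemLp φ 2)
    (hlim : ∀ᵐ x : ℝ, Tendsto (fun y : ℝ => F ((x : ℂ) + (y : ℂ) * Complex.I)) (𝓝[>] 0) (𝓝 (φ x)))
    {w : ℂ} (hw : 0 < w.im) :
    Integrable (fun x : ℝ => ‖φ x‖ ^ 2 * (‖(x : ℂ) - w‖ ^ 2)⁻¹) ∧
    ‖F w‖ ^ 2 ≤ w.im / Real.pi * ∫ x : ℝ, ‖φ x‖ ^ 2 * (‖(x : ℂ) - w‖ ^ 2)⁻¹ := by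
  set p : ℝ → ℝ := fun x => (‖(x : ℂ) - w‖ ^ 2)⁻¹ with hp
  have hpn : ∀ x, 0 ≤ p x := fun x => by positivity
  have hpi : Integrable p := integrable_inv_norm_sq hw
  have hsq : Integrable fun x => ‖φ x‖ ^ 2 := (memLp_two_iff_integrable_sq_norm hφ.1).1 hφ
  have hi1 : Integrable fun x : ℝ => ‖φ x‖ ^ 2 * p x :=
    hsq.mul_bdd (c := (w.im ^ 2)⁻¹) (continuous_inv_norm_sq hw).aestronglyMeasurable
      (Eventually.of_forall fun x => by
        rw [Real.norm_of_nonneg (by positivity)]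
        exact inv_norm_sq_le hw x)
  have hi2 : Integrable fun x : ℝ => φ x * (p x : ℂ) := hφ.integrable_mul (memLp_inv_norm_sq hw)
  have hi3 : Integrable fun x : ℝ => 2 * (conj (F w) * (φ x * (p x : ℂ))).re :=
    ((hi2.const_mul _).re).const_mul 2
  have hP := hF.integral_poisson hφ hlim hw
  refine ⟨hi1, ?_⟩
  -- `F w` is the mean of `φ` for the Poisson kernel; expand the variance of `φ` about it.
  have h0 : 0 ≤ ∫ x : ℝ, ‖φ x - F w‖ ^ 2 * p x :=
    integral_nonneg fun x => mul_nonneg (by positivity) (hpn x)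
  have h1 : ∀ x : ℝ, ‖φ x - F w‖ ^ 2 * p x =
      ‖φ x‖ ^ 2 * p x - 2 * (conj (F w) * (φ x * (p x : ℂ))).re + ‖F w‖ ^ 2 * p x := by
    intro x
    rw [← Complex.normSq_eq_norm_sq, ← Complex.normSq_eq_norm_sq, ← Complex.normSq_eq_norm_sq,
      Complex.normSq_apply, Complex.normSq_apply, Complex.normSq_apply]
    simp
    ring
  simp only [h1] at h0
  have hi13 : Integrable fun x : ℝ => ‖φ x‖ ^ 2 * p x -
      2 * (conj (F w) * (φ x * (p x : ℂ))).re := hi1.sub hi3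
  rw [integral_add hi13 (hpi.const_mul _), integral_sub hi1 hi3, integral_const_mul,
    integral_const_mul] at h0
  have h2 : ∫ x : ℝ, (conj (F w) * (φ x * (p x : ℂ))).re = Real.pi / w.im * ‖F w‖ ^ 2 := by
    have h3 : ∫ x : ℝ, (conj (F w) * (φ x * (p x : ℂ))).re =
      (∫ x : ℝ, conj (F w) * (φ x * (p x : ℂ))).re := integral_re (𝕜 := ℂ) (hi2.const_mul _)
    rw [h3, integral_const_mul, hP, ← Complex.normSq_eq_norm_sq]
    have h4 : conj (F w) * (Real.pi / w.im * F w) =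
        ((Real.pi / w.im * Complex.normSq (F w) : ℝ) : ℂ) := by
      push_cast
      rw [← Complex.mul_conj]
      ring
    rw [h4, Complex.ofReal_re]
  rw [h2, integral_inv_norm_sq hw] at h0
  have hpi0 := Real.pi_pos
  have h5 : Real.pi / w.im * ‖F w‖ ^ 2 ≤ ∫ x : ℝ, ‖φ x‖ ^ 2 * p x := by linarith
  calc ‖F w‖ ^ 2 = w.im / Real.pi * (Real.pi / w.im * ‖F w‖ ^ 2) := by field_simp
    _ ≤ _ := by gcongr

theorem IsHardyH2.norm_sq_le {F : ℂ → ℂ} (hF : IsHardyH2 F) {φ : ℝ → ℂ} (hφ : MemLp φ 2)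
    (hlim : ∀ᵐ x : ℝ, Tendsto (fun y : ℝ => F ((x : ℂ) + (y : ℂ) * Complex.I)) (𝓝[>] 0) (𝓝 (φ x)))
    {w : ℂ} (hw : 0 < w.im) :
    ‖F w‖ ^ 2 ≤ (∫ x : ℝ, ‖φ x‖ ^ 2) / (Real.pi * w.im) := by
  obtain ⟨hi, h⟩ := hF.norm_sq_le_integral hφ hlim hw
  have hsq : Integrable fun x => ‖φ x‖ ^ 2 := (memLp_two_iff_integrable_sq_norm hφ.1).1 hφ
  have h1 : ∫ x : ℝ, ‖φ x‖ ^ 2 * (‖(x : ℂ) - w‖ ^ 2)⁻¹ ≤ (∫ x : ℝ, ‖φ x‖ ^ 2) * (w.im ^ 2)⁻¹ := by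
    rw [← integral_mul_const]
    exact integral_mono hi (hsq.mul_const _) fun x =>
      mul_le_mul_of_nonneg_left (inv_norm_sq_le hw x) (by positivity)
  have hpi0 := Real.pi_pos
  calc ‖F w‖ ^ 2 ≤ w.im / Real.pi * ((∫ x : ℝ, ‖φ x‖ ^ 2) * (w.im ^ 2)⁻¹) := h.trans (by gcongr)
    _ = _ := by field_simp

/-- On each horizontal line, the `L²` norm of a Hardy space function is at most that of its
boundary values. -/
theorem IsHardyH2.lintegral_line_le {F : ℂ → ℂ} (hF : IsHardyH2 F) {φ : ℝ → ℂ} (hφ : MemLp φ 2)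
    (hφm : Measurable φ)
    (hlim : ∀ᵐ x : ℝ, Tendsto (fun y : ℝ => F ((x : ℂ) + (y : ℂ) * Complex.I)) (𝓝[>] 0) (𝓝 (φ x)))
    {y : ℝ} (hy : 0 < y) :
    ∫⁻ x : ℝ, ‖F ((x : ℂ) + (y : ℂ) * Complex.I)‖ₑ ^ 2 ≤ ∫⁻ x : ℝ, ‖φ x‖ₑ ^ 2 := by
  have hpi0 := Real.pi_pos
  set q : ℝ → ℝ → ℝ≥0∞ := fun x t =>
    ENNReal.ofReal (y / Real.pi * (‖(t : ℂ) - (x + y * Complex.I)‖ ^ 2)⁻¹) with hq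
  have hqm : Measurable (Function.uncurry q) := by
    simp only [hq, Function.uncurry_def]
    fun_prop
  have him : ∀ x : ℝ, ((x : ℂ) + y * Complex.I).im = y := fun x => by simp
  have him' : ∀ x : ℝ, 0 < ((x : ℂ) + y * Complex.I).im := fun x => by rwa [him]
  have hq1 : ∀ t : ℝ, ∫⁻ x : ℝ, q x t = 1 := by
    intro t
    have h1 : ∀ x : ℝ, q x t =
        ENNReal.ofReal (y / Real.pi * (‖(x : ℂ) - (t + y * Complex.I)‖ ^ 2)⁻¹) := by
      intro x
      simp only [hq]
      rw [norm_ofReal_sub_sq, norm_ofReal_sub_sq]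
      simp only [Complex.add_re, Complex.ofReal_re, Complex.mul_re, Complex.I_re, mul_zero,
        Complex.ofReal_im, Complex.I_im, mul_one, sub_self, add_zero, Complex.add_im,
        Complex.mul_im, zero_add]
      rw [← neg_sub x t, neg_sq]
    simp only [h1]
    rw [← ofReal_integral_eq_lintegral_ofReal ((integrable_inv_norm_sq (him' t)).const_mul _)
      (Eventually.of_forall fun x => by positivity), integral_const_mul,
      integral_inv_norm_sq (him' t), him]
    rw [div_mul_div_cancel₀ hpi0.ne', div_self hy.ne', ENNReal.ofReal_one]
  calc ∫⁻ x : ℝ, ‖F ((x : ℂ) + (y : ℂ) * Complex.I)‖ₑ ^ 2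
      ≤ ∫⁻ x : ℝ, ∫⁻ t : ℝ, ‖φ t‖ₑ ^ 2 * q x t := by
        refine lintegral_mono fun x => ?_
        obtain ⟨hi, h⟩ := hF.norm_sq_le_integral hφ hlim (him' x)
        rw [him] at h
        have h1 : ‖F ((x : ℂ) + (y : ℂ) * Complex.I)‖ₑ ^ 2 =
            ENNReal.ofReal (‖F ((x : ℂ) + (y : ℂ) * Complex.I)‖ ^ 2) := by
          rw [ENNReal.ofReal_pow (norm_nonneg _), ofReal_norm]
        rw [h1]
        refine (ENNReal.ofReal_le_ofReal h).trans (le_of_eq ?_)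
        rw [← integral_const_mul, ofReal_integral_eq_lintegral_ofReal (hi.const_mul _)
          (Eventually.of_forall fun t => by positivity)]
        refine lintegral_congr fun t => ?_
        rw [mul_left_comm, ENNReal.ofReal_mul (by positivity),
          ENNReal.ofReal_pow (norm_nonneg _), ofReal_norm]
    _ = ∫⁻ t : ℝ, ∫⁻ x : ℝ, ‖φ t‖ₑ ^ 2 * q x t := by
        refine lintegral_lintegral_swap (Measurable.aemeasurable ?_)
        exact ((hφm.comp measurable_snd).enorm.pow_const 2).mul hqm
    _ = ∫⁻ t : ℝ, ‖φ t‖ₑ ^ 2 := by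
        refine lintegral_congr fun t => ?_
        rw [lintegral_const_mul _ (by simp only [hq]; fun_prop), hq1, mul_one]

/-! ### Functions with a singularity of order `1 / |Im z|` on the real line -/

/-- The factor `z² - R²`, of modulus `2R |Im z|` on the circle `|z| = R`, absorbs a singularity of
order `1 / |Im z|`, so that the maximum principle applies. -/
theorem norm_mul_sq_sub_le {φ : ℂ → ℂ} (hφ : Differentiable ℂ φ) {R K : ℝ} (hR : 0 < R)
    (hK : ∀ z : ℂ, z.im ≠ 0 → ‖z‖ = R → ‖φ z‖ * |z.im| ≤ K) {z : ℂ} (hz : ‖z‖ ≤ R) :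
    ‖φ z‖ * ‖z ^ 2 - R ^ 2‖ ≤ 2 * R * K := by
  have hK0 : 0 ≤ K := by
    have := hK (R * Complex.I) (by simp [hR.ne']) (by simp [abs_of_pos hR])
    exact le_trans (by positivity) this
  rw [← norm_mul]
  refine Complex.norm_le_of_forall_mem_frontier_norm_le (f := fun z => φ z * (z ^ 2 - (R : ℂ) ^ 2))
    (U := Metric.ball 0 R) Metric.isBounded_ball (Differentiable.diffContOnCl (by fun_prop))
    (fun ζ hζ => ?_) (z := z) ?_
  · rw [frontier_ball _ hR.ne', mem_sphere_zero_iff_norm] at hζ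
    -- On the circle, `z² - R² = 2 i z Im z`.
    have h1 : ζ ^ 2 - (R : ℂ) ^ 2 = 2 * Complex.I * ζ * ζ.im := by
      have h2 : (R : ℂ) ^ 2 = ζ * conj ζ := by
        rw [Complex.mul_conj, Complex.normSq_eq_norm_sq, hζ]
        push_cast
        rfl
      have h3 : ζ - conj ζ = 2 * Complex.I * ζ.im := by
        rw [Complex.sub_conj]
        push_cast
        ring
      rw [h2]
      linear_combination ζ * h3
    rw [h1, norm_mul, norm_mul, norm_mul, norm_mul, hζ, Complex.norm_I, Complex.norm_real,
      Real.norm_eq_abs]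
    by_cases h0 : ζ.im = 0
    · rw [h0]
      simp only [abs_zero, mul_zero]
      positivity
    · calc ‖φ ζ‖ * (‖(2 : ℂ)‖ * 1 * R * |ζ.im|) = 2 * R * (‖φ ζ‖ * |ζ.im|) := by
            rw [Complex.norm_two]
            ring
        _ ≤ _ := by
            gcongr
            exact hK ζ h0 hζ
  · rw [closure_ball _ hR.ne']
    simpa using hz

/-- An entire function which is `O(1 / |Im z|)` vanishes. -/
theorem eq_zero_of_norm_mul_abs_im_le {φ : ℂ → ℂ} (hφ : Differentiable ℂ φ) {K : ℝ}
    (hK : ∀ z : ℂ, z.im ≠ 0 → ‖φ z‖ * |z.im| ≤ K) : φ = 0 := by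
  funext z
  have h1 : Tendsto (fun R : ℝ => 8 * K / R) atTop (𝓝 0) :=
    tendsto_const_nhds.div_atTop tendsto_id
  refine norm_le_zero_iff.1 (ge_of_tendsto h1 ?_)
  filter_upwards [eventually_gt_atTop 0, eventually_ge_atTop (2 * ‖z‖)] with R hR hRz
  have h2 := norm_mul_sq_sub_le hφ hR (fun ζ h _ => hK ζ h) (z := z) (by linarith [norm_nonneg z])
  have h3 : R ^ 2 / 4 ≤ ‖z ^ 2 - (R : ℂ) ^ 2‖ := by
    have h4 := norm_sub_norm_le ((R : ℂ) ^ 2) (z ^ 2)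
    rw [norm_sub_rev, norm_pow, norm_pow, Complex.norm_real, Real.norm_of_nonneg hR.le] at h4
    nlinarith [norm_nonneg z]
  rw [le_div_iff₀ hR]
  have h5 : ‖φ z‖ * (R ^ 2 / 4) ≤ 2 * R * K := (by gcongr : _ ≤ _).trans h2
  have h6 : (‖φ z‖ * R) * R ≤ 8 * K * R := by linarith
  exact le_of_mul_le_mul_right h6 hR

/-! ### The de Branges space as a reproducing kernel Hilbert space -/

theorem sharp_sharp (f : ℂ → ℂ) : sharp (sharp f) = f := by
  funext z
  simp [sharp]

theorem sharp_ofReal (f : ℂ → ℂ) (x : ℝ) : sharp f x = conj (f x) := by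
  simp [sharp]

theorem Differentiable.sharp {f : ℂ → ℂ} (hf : Differentiable ℂ f) :
    Differentiable ℂ (sharp f) := by
  intro z
  have h := (hf (conj z)).conj_conj
  rw [Complex.conj_conj] at h
  exact h

/-- A pointwise limit of functions with uniformly bounded `H_2` norms is in `H_2`, if it is
holomorphic. -/
theorem IsHardyH2.of_tendsto {F : ℂ → ℂ} {Fn : ℕ → ℂ → ℂ}
    (hF : DifferentiableOn ℂ F {z : ℂ | 0 < z.im}) (hFn : ∀ n, IsHardyH2 (Fn n)) {D : ℝ≥0∞}
    (hD : D ≠ ∞)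
    (hb : ∀ n, ∀ y : ℝ, 0 < y → ∫⁻ x : ℝ, ‖Fn n ((x : ℂ) + (y : ℂ) * Complex.I)‖ₑ ^ 2 ≤ D)
    (hlim : ∀ z : ℂ, 0 < z.im → Tendsto (fun n => Fn n z) atTop (𝓝 (F z))) : IsHardyH2 F := by
  refine ⟨hF, lt_of_le_of_lt (iSup₂_le fun y hy => ?_) hD.lt_top⟩
  calc ∫⁻ x : ℝ, ‖F ((x : ℂ) + (y : ℂ) * Complex.I)‖ₑ ^ 2
      = ∫⁻ x : ℝ, liminf (fun n => ‖Fn n ((x : ℂ) + (y : ℂ) * Complex.I)‖ₑ ^ 2) atTop := by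
        refine lintegral_congr fun x => ?_
        have h1 := hlim ((x : ℂ) + (y : ℂ) * Complex.I) (by simpa using hy)
        exact (((ENNReal.continuous_pow 2).tendsto _).comp h1.enorm).liminf_eq.symm
    _ ≤ liminf (fun n => ∫⁻ x : ℝ, ‖Fn n ((x : ℂ) + (y : ℂ) * Complex.I)‖ₑ ^ 2) atTop :=
        lintegral_liminf_le fun n => ((hFn n).continuous_line hy).measurable.enorm.pow_const 2
    _ ≤ D := liminf_le_of_frequently_le' (Frequently.of_forall fun n => hb n y hy)

namespace HermiteBiehler

variable {e : HermiteBiehler}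

/-- The conjugation `f ↦ f^#` of `B(e)`. -/
def Space.sharp (f : e.Space) : e.Space :=
  Space.mk (_root_.sharp f) ⟨f.mem.1.sharp, f.mem.2.2, by
    rw [sharp_sharp]
    exact f.mem.2.1⟩

theorem Space.coe_sharp (f : e.Space) : ⇑f.sharp = _root_.sharp f := rfl

theorem Space.sharp_ofReal_apply (f : e.Space) (x : ℝ) : f.sharp x = conj (f x) :=
  _root_.sharp_ofReal f x

theorem Space.sub_apply (f g : e.Space) (z : ℂ) : (f - g) z = f z - g z := rfl

theorem Space.ext {f g : e.Space} (h : ∀ z, f z = g z) : f = g :=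
  DFunLike.coe_injective (funext h)

theorem Space.differentiable (f : e.Space) : Differentiable ℂ f := f.mem.1

theorem Space.measurable_div (f : e.Space) : Measurable fun x : ℝ => f x / e x :=
  (f.differentiable.continuous.comp Complex.continuous_ofReal).measurable.div
    (e.differentiable.continuous.comp Complex.continuous_ofReal).measurable

theorem norm_sq_eq (f : e.Space) : ‖f‖ ^ 2 = ∫ x : ℝ, ‖f x / e x‖ ^ 2 := by
  have h1 : ‖f‖ ^ 2 = (inner ℂ f f).re := norm_sq_eq_re_inner (𝕜 := ℂ) f
  rw [h1, inner_def]
  have h : ∀ x : ℝ, conj (f x) * f x / ((‖e x‖ ^ 2 : ℝ) : ℂ) = ((‖f x / e x‖ ^ 2 : ℝ) : ℂ) := by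
    intro x
    rw [mul_comm, Complex.mul_conj, Complex.normSq_eq_norm_sq, norm_div, div_pow]
    push_cast
    rfl
  simp only [h]
  rw [integral_complex_ofReal, Complex.ofReal_re]

theorem lintegral_enorm_sq_div (f : e.Space) :
    ∫⁻ x : ℝ, ‖f x / e x‖ₑ ^ 2 = ENNReal.ofReal (‖f‖ ^ 2) := by
  rw [lintegral_enorm_sq_eq (memLp_div f), norm_sq_eq]

theorem norm_sharp (f : e.Space) : ‖f.sharp‖ = ‖f‖ := by
  have : ‖f.sharp‖ ^ 2 = ‖f‖ ^ 2 := by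
    simp only [norm_sq_eq, Space.sharp_ofReal_apply, norm_div, RCLike.norm_conj]
  exact (pow_left_inj₀ (norm_nonneg _) (norm_nonneg _) two_ne_zero).1 this

theorem tendsto_div_boundary (f : e.Space) : ∀ᵐ x : ℝ,
    Tendsto (fun y : ℝ => f ((x : ℂ) + (y : ℂ) * Complex.I) / e ((x : ℂ) + (y : ℂ) * Complex.I))
      (𝓝[>] 0) (𝓝 (f x / e x)) := by
  filter_upwards [ae_real_ne_zero (e := e)] with x hx
  have h1 : Tendsto (fun y : ℝ => (x : ℂ) + (y : ℂ) * Complex.I) (𝓝[>] 0) (𝓝 (x : ℂ)) := by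
    have : Continuous (fun y : ℝ => (x : ℂ) + (y : ℂ) * Complex.I) := by fun_prop
    exact (this.tendsto' 0 (x : ℂ) (by simp)).mono_left nhdsWithin_le_nhds
  exact ((f.differentiable.continuous.tendsto (x : ℂ)).comp h1).div
      ((e.differentiable.continuous.tendsto (x : ℂ)).comp h1) hx

theorem integral_poisson (f : e.Space) {w : ℂ} (hw : 0 < w.im) :
    ∫ x : ℝ, f x / e x * ((‖(x : ℂ) - w‖ ^ 2)⁻¹ : ℝ) = Real.pi / w.im * (f w / e w) :=
  f.mem.2.1.integral_poisson (memLp_div f) (tendsto_div_boundary f) hw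

theorem norm_div_sq_le (f : e.Space) {w : ℂ} (hw : 0 < w.im) :
    ‖f w / e w‖ ^ 2 ≤ ‖f‖ ^ 2 / (Real.pi * w.im) := by
  rw [norm_sq_eq]
  exact f.mem.2.1.norm_sq_le (memLp_div f) (tendsto_div_boundary f) hw

theorem lintegral_line_le (f : e.Space) {y : ℝ} (hy : 0 < y) :
    ∫⁻ x : ℝ, ‖f ((x : ℂ) + (y : ℂ) * Complex.I) / e ((x : ℂ) + (y : ℂ) * Complex.I)‖ₑ ^ 2 ≤
      ENNReal.ofReal (‖f‖ ^ 2) := by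
  rw [← lintegral_enorm_sq_div]
  exact f.mem.2.1.lintegral_line_le (memLp_div f) f.measurable_div (tendsto_div_boundary f) hy

/-- By the Poisson estimate, `f / e` tends to zero along the imaginary axis. -/
theorem tendsto_div_imaginary_axis (f : e.Space) :
    Tendsto (fun y : ℝ => f (y * Complex.I) / e (y * Complex.I)) atTop (𝓝 0) := by
  rw [tendsto_zero_iff_norm_tendsto_zero]
  have h1 : Tendsto (fun y : ℝ => ‖f‖ ^ 2 / (Real.pi * y)) atTop (𝓝 0) :=
    tendsto_const_nhds.div_atTop (tendsto_id.const_mul_atTop Real.pi_pos)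
  have h2 : Tendsto (fun y : ℝ => ‖f (y * Complex.I) / e (y * Complex.I)‖ ^ 2) atTop (𝓝 0) := by
    refine squeeze_zero' (Eventually.of_forall fun y => by positivity) ?_ h1
    filter_upwards [eventually_gt_atTop 0] with y hy
    have := norm_div_sq_le f (w := y * Complex.I) (by simpa using hy)
    simpa using this
  have h3 := h2.sqrt
  simpa only [Real.sqrt_sq (norm_nonneg _), Real.sqrt_zero] using h3

/-- Evaluation is bounded on `B(e)`, locally uniformly in the point. Off the real line this is the
Poisson estimate; the singularity of that estimate on the real line is removed by the maximum
principle. -/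
theorem exists_norm_apply_le (e : HermiteBiehler) {r : ℝ} (hr : 0 < r) :
    ∃ C : ℝ, 0 ≤ C ∧ ∀ (f : e.Space) (z : ℂ), ‖z‖ ≤ r → ‖f z‖ ≤ C * ‖f‖ := by
  obtain ⟨M, hM⟩ := (isCompact_closedBall (0 : ℂ) (2 * r)).exists_bound_of_continuousOn
    e.differentiable.continuous.continuousOn
  have hM0 : 0 ≤ M := (norm_nonneg _).trans (hM 0 (by simp; positivity))
  set B := Real.sqrt (2 * r) * M with hB
  have hup : ∀ (f : e.Space) (z : ℂ), 0 < z.im → ‖z‖ = 2 * r → ‖f z‖ * z.im ≤ B * ‖f‖ := by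
    intro f z hz hzr
    have h1 := norm_div_sq_le f hz
    have hpi : 1 ≤ Real.pi := by linarith [Real.pi_gt_three]
    have h2 : (‖f z / e z‖ * z.im) ^ 2 ≤ (Real.sqrt (2 * r) * ‖f‖) ^ 2 := by
      rw [mul_pow, mul_pow, Real.sq_sqrt (by positivity)]
      calc ‖f z / e z‖ ^ 2 * z.im ^ 2 ≤ ‖f‖ ^ 2 / (Real.pi * z.im) * z.im ^ 2 := by gcongr
        _ = z.im / Real.pi * ‖f‖ ^ 2 := by field_simp
        _ ≤ 2 * r * ‖f‖ ^ 2 := by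
            gcongr
            rw [← hzr]
            exact (div_le_self hz.le hpi).trans ((le_abs_self _).trans z.abs_im_le_norm)
    have h3 := (le_abs_self _).trans (abs_le_of_sq_le_sq h2 (by positivity))
    have h4 : ‖f z‖ = ‖e z‖ * ‖f z / e z‖ := by
      rw [← norm_mul, mul_div_cancel₀ _ (ne_zero hz)]
    calc ‖f z‖ * z.im = ‖e z‖ * (‖f z / e z‖ * z.im) := by rw [h4]; ring
      _ ≤ M * (Real.sqrt (2 * r) * ‖f‖) := by
          exact mul_le_mul (hM z (by simpa using hzr.le)) h3 (by positivity) hM0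
      _ = B * ‖f‖ := by rw [hB]; ring
  have hoff : ∀ (f : e.Space) (z : ℂ), z.im ≠ 0 → ‖z‖ = 2 * r → ‖f z‖ * |z.im| ≤ B * ‖f‖ := by
    intro f z hz hzr
    rcases lt_or_gt_of_ne hz with h | h
    · have h1 := hup f.sharp (conj z) (by simpa using h) (by simpa using hzr)
      rw [norm_sharp] at h1
      simpa [Space.coe_sharp, sharp, abs_of_neg h] using h1
    · rw [abs_of_pos h]
      exact hup f z h hzr
  refine ⟨4 * r * B / (3 * r ^ 2), by positivity, fun f z hz => ?_⟩
  have h1 := norm_mul_sq_sub_le f.differentiable (by positivity : 0 < 2 * r) (hoff f)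
    (z := z) (by linarith)
  have h2 : 3 * r ^ 2 ≤ ‖z ^ 2 - ((2 * r : ℝ) : ℂ) ^ 2‖ := by
    have h4 := norm_sub_norm_le (((2 * r : ℝ) : ℂ) ^ 2) (z ^ 2)
    rw [norm_sub_rev, norm_pow, norm_pow, Complex.norm_real,
      Real.norm_of_nonneg (by positivity)] at h4
    nlinarith [norm_nonneg z]
  rw [div_mul_eq_mul_div, le_div_iff₀ (by positivity)]
  calc ‖f z‖ * (3 * r ^ 2) ≤ ‖f z‖ * ‖z ^ 2 - ((2 * r : ℝ) : ℂ) ^ 2‖ := by gcongr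
    _ ≤ _ := h1
    _ = _ := by ring

instance : CompleteSpace e.Space := by
  refine Metric.complete_of_cauchySeq_tendsto fun u hu => ?_
  have hpt : ∀ z : ℂ, ∃ a, Tendsto (fun n => u n z) atTop (𝓝 a) := by
    intro z
    obtain ⟨C, hC0, hC⟩ := exists_norm_apply_le e (r := ‖z‖ + 1) (by positivity)
    refine cauchySeq_tendsto_of_complete (Metric.cauchySeq_iff.2 fun ε hε => ?_)
    obtain ⟨N, hN⟩ := Metric.cauchySeq_iff.1 hu (ε / (C + 1)) (by positivity)
    refine ⟨N, fun m hm n hn => ?_⟩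
    have h1 := hN m hm n hn
    rw [dist_eq_norm] at h1 ⊢
    rw [lt_div_iff₀ (by positivity)] at h1
    rw [← Space.sub_apply]
    have := hC (u m - u n) z (by linarith)
    nlinarith [norm_nonneg (u m - u n)]
  choose f hf using hpt
  have hunif : ∀ r : ℝ, 0 < r → TendstoUniformlyOn (fun n z => u n z) f atTop
      (Metric.closedBall 0 r) := by
    intro r hr
    refine UniformCauchySeqOn.tendstoUniformlyOn_of_tendsto ?_ fun z _ => hf z
    obtain ⟨C, hC0, hC⟩ := exists_norm_apply_le e hr
    rw [Metric.uniformCauchySeqOn_iff]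
    intro ε hε
    obtain ⟨N, hN⟩ := Metric.cauchySeq_iff.1 hu (ε / (C + 1)) (by positivity)
    refine ⟨N, fun m hm n hn z hz => ?_⟩
    have h1 := hN m hm n hn
    rw [dist_eq_norm] at h1 ⊢
    rw [lt_div_iff₀ (by positivity)] at h1
    rw [← Space.sub_apply]
    have := hC (u m - u n) z (by simpa using hz)
    nlinarith [norm_nonneg (u m - u n)]
  have hfd : Differentiable ℂ f := by
    rw [← differentiableOn_univ]
    refine TendstoLocallyUniformlyOn.differentiableOn (F := fun n z => u n z) (φ := atTop) ?_
      (Eventually.of_forall fun n => (u n).differentiable.differentiableOn) isOpen_univ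
    rw [tendstoLocallyUniformlyOn_iff_forall_isCompact isOpen_univ]
    intro K _ hK
    obtain ⟨r, hr⟩ := hK.isBounded.subset_closedBall 0
    exact (hunif (max r 1) (by positivity)).mono
      (hr.trans (Metric.closedBall_subset_closedBall (le_max_left _ _)))
  obtain ⟨b, -, hb⟩ := cauchySeq_bdd hu
  obtain ⟨D, hD'⟩ : ∃ D, ∀ n, ‖u n‖ ≤ D := by
    refine ⟨b + ‖u 0‖, fun n => ?_⟩
    have h1 := hb n 0
    rw [dist_eq_norm] at h1
    linarith [norm_sub_norm_le (u n) (u 0)]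
  have hmem : f ∈ e.functions := by
    refine ⟨hfd, ?_, ?_⟩
    · refine IsHardyH2.of_tendsto (Fn := fun n z => u n z / e z) (D := ENNReal.ofReal (D ^ 2))
        (hfd.differentiableOn.div e.differentiable.differentiableOn fun z hz => ne_zero hz)
        (fun n => (u n).mem.2.1) ENNReal.ofReal_ne_top (fun n y hy => ?_)
        (fun z hz => (hf z).div_const _)
      refine (lintegral_line_le (u n) hy).trans (ENNReal.ofReal_le_ofReal ?_)
      gcongr
      exact hD' n
    · refine IsHardyH2.of_tendsto (Fn := fun n z => (u n).sharp z / e z)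
        (D := ENNReal.ofReal (D ^ 2))
        (hfd.sharp.differentiableOn.div e.differentiable.differentiableOn fun z hz => ne_zero hz)
        (fun n => (u n).sharp.mem.2.1) ENNReal.ofReal_ne_top (fun n y hy => ?_)
        (fun z hz => ?_)
      · refine (lintegral_line_le (u n).sharp hy).trans (ENNReal.ofReal_le_ofReal ?_)
        rw [norm_sharp]
        gcongr
        exact hD' n
      · refine Tendsto.div_const ?_ _
        exact (Complex.continuous_conj.tendsto _).comp (hf (conj z))
  refine ⟨Space.mk f hmem, Metric.tendsto_atTop.2 fun ε hε => ?_⟩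
  obtain ⟨N, hN⟩ := Metric.cauchySeq_iff.1 hu (ε / 2) (by positivity)
  refine ⟨N, fun n hn => ?_⟩
  rw [dist_eq_norm]
  have h1 : ENNReal.ofReal (‖u n - Space.mk f hmem‖ ^ 2) ≤ ENNReal.ofReal ((ε / 2) ^ 2) := by
    rw [← lintegral_enorm_sq_div]
    calc ∫⁻ x : ℝ, ‖(u n - Space.mk f hmem) x / e x‖ₑ ^ 2
        = ∫⁻ x : ℝ, liminf (fun m => ‖(u n - u m) x / e x‖ₑ ^ 2) atTop := by
          refine lintegral_congr fun x => ?_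
          have h1 : Tendsto (fun m => (u n - u m) x / e x) atTop
              (𝓝 ((u n - Space.mk f hmem) x / e x)) :=
            ((hf x).const_sub (u n x)).div_const _
          exact (((ENNReal.continuous_pow 2).tendsto _).comp h1.enorm).liminf_eq.symm
      _ ≤ liminf (fun m => ∫⁻ x : ℝ, ‖(u n - u m) x / e x‖ₑ ^ 2) atTop :=
          lintegral_liminf_le fun m => (u n - u m).measurable_div.enorm.pow_const 2
      _ ≤ ENNReal.ofReal ((ε / 2) ^ 2) := by
          refine liminf_le_of_frequently_le' (Eventually.frequently ?_)
          filter_upwards [eventually_ge_atTop N] with m hm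
          rw [lintegral_enorm_sq_div]
          have := (hN n hn m hm).le
          rw [dist_eq_norm] at this
          exact ENNReal.ofReal_le_ofReal (by gcongr)
  rw [ENNReal.ofReal_le_ofReal_iff (by positivity)] at h1
  have h2 := abs_le_of_sq_le_sq h1 (by positivity)
  linarith [(le_abs_self _).trans h2]

end HermiteBiehler

/-! ### Division by `z - w` in the Hardy space -/

/-- Division by `z - w`, with `w` off the real line, maps sums of a Hardy space function and a
bounded function to the Hardy space, if the quotient is holomorphic. -/
theorem IsHardyH2.of_sub_mul_eq {F G b : ℂ → ℂ} {w : ℂ} {K : ℝ} (hw : w.im ≠ 0)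
    (hF : DifferentiableOn ℂ F {z : ℂ | 0 < z.im}) (hG : IsHardyH2 G)
    (hb : ∀ z : ℂ, 0 < z.im → ‖b z‖ ≤ K)
    (h : ∀ z : ℂ, 0 < z.im → (z - w) * F z = G z + b z) : IsHardyH2 F := by
  set ρ := |w.im| / 2 with hρ
  have hρ0 : 0 < ρ := by have := abs_pos.2 hw; positivity
  obtain ⟨M, hM0, hM⟩ : ∃ M : ℝ, 0 ≤ M ∧ ∀ z : ℂ, ‖z - w‖ ≤ ρ → 0 < z.im → ‖F z‖ ≤ M := by
    have him : ∀ z : ℂ, ‖z - w‖ ≤ ρ → |z.im - w.im| ≤ |w.im| / 2 := fun z hz =>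
      (by simpa using Complex.abs_im_le_norm (z - w) : |z.im - w.im| ≤ ‖z - w‖).trans hz
    rcases lt_or_gt_of_ne hw with h0 | h0
    · refine ⟨0, le_rfl, fun z hz hz0 => ?_⟩
      have h1 := him z hz
      rw [abs_of_neg h0] at h1
      linarith [(abs_le.1 h1).2]
    · obtain ⟨M, hM⟩ := (isCompact_closedBall w ρ).exists_bound_of_continuousOn
        (hF.continuousOn.mono fun z hz => by
          rw [mem_closedBall_iff_norm] at hz
          have h1 := him z hz
          rw [abs_of_pos h0] at h1
          have h2 : 0 < z.im := by linarith [(abs_le.1 h1).1]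
          exact h2)
      refine ⟨max M 0, le_max_right _ _, fun z hz _ => ?_⟩
      exact (hM z (by rwa [mem_closedBall_iff_norm])).trans (le_max_left _ _)
  have hK0 : 0 ≤ K := (norm_nonneg _).trans (hb Complex.I (by simp))
  -- On the disc of radius `ρ` about `w`, `F` is bounded; outside of it one divides by `z - w`.
  -- The point `w'` serves to write the dominating function as a Poisson kernel.
  set w' : ℂ := w.re + ρ * Complex.I with hw'
  have hw'im : w'.im = ρ := by simp [hw']
  have hw'0 : 0 < w'.im := by rwa [hw'im]
  have hpx : ∀ x : ℝ, ‖(x : ℂ) - w'‖ ^ 2 = (x - w.re) ^ 2 + ρ ^ 2 := by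
    intro x
    rw [norm_ofReal_sub_sq, hw'im]
    simp [hw']
  set A := M ^ 2 * (2 * ρ ^ 2) + 4 * K ^ 2 with hA
  have key : ∀ x y : ℝ, 0 < y → ‖F ((x : ℂ) + (y : ℂ) * Complex.I)‖ ^ 2 ≤
      2 / ρ ^ 2 * ‖G ((x : ℂ) + (y : ℂ) * Complex.I)‖ ^ 2 + A * (‖(x : ℂ) - w'‖ ^ 2)⁻¹ := by
    intro x y hy
    set z : ℂ := (x : ℂ) + (y : ℂ) * Complex.I with hz
    have hzre : z.re = x := by simp [hz]
    have hzim : 0 < z.im := by simpa [hz] using hy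
    have hq : 0 < (x - w.re) ^ 2 + ρ ^ 2 := by positivity
    have hre : (x - w.re) ^ 2 ≤ ‖z - w‖ ^ 2 := by
      have := Complex.abs_re_le_norm (z - w)
      rw [Complex.sub_re, hzre] at this
      rw [← sq_abs]
      gcongr
    rw [hpx, hA, add_mul]
    by_cases hd : ‖z - w‖ ≤ ρ
    · have h1 : ‖F z‖ ^ 2 ≤ M ^ 2 := by gcongr; exact hM z hd hzim
      have h2 : (x - w.re) ^ 2 ≤ ρ ^ 2 := hre.trans (by gcongr)
      have h3 : M ^ 2 ≤ M ^ 2 * (2 * ρ ^ 2) * ((x - w.re) ^ 2 + ρ ^ 2)⁻¹ := by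
        rw [← div_eq_mul_inv, le_div_iff₀ hq]
        gcongr
        linarith
      have h4 : 0 ≤ 2 / ρ ^ 2 * ‖G z‖ ^ 2 := by positivity
      have h5 : 0 ≤ 4 * K ^ 2 * ((x - w.re) ^ 2 + ρ ^ 2)⁻¹ := by positivity
      linarith
    · rw [not_le] at hd
      have hd0 : 0 < ‖z - w‖ := hρ0.trans hd
      have h1 : ‖z - w‖ * ‖F z‖ ≤ ‖G z‖ + K := by
        rw [← norm_mul, h z hzim]
        exact (norm_add_le _ _).trans (by gcongr; exact hb z hzim)
      have h2 : (‖z - w‖ * ‖F z‖) ^ 2 ≤ 2 * ‖G z‖ ^ 2 + 2 * K ^ 2 := by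
        have : (‖z - w‖ * ‖F z‖) ^ 2 ≤ (‖G z‖ + K) ^ 2 := by gcongr
        nlinarith [sq_nonneg (‖G z‖ - K)]
      have hρd : ρ ^ 2 ≤ ‖z - w‖ ^ 2 := by gcongr
      have h3 : 2 * ‖G z‖ ^ 2 / ‖z - w‖ ^ 2 ≤ 2 / ρ ^ 2 * ‖G z‖ ^ 2 := by
        rw [div_mul_eq_mul_div]
        gcongr
      have h4 : 2 * K ^ 2 / ‖z - w‖ ^ 2 ≤ 4 * K ^ 2 * ((x - w.re) ^ 2 + ρ ^ 2)⁻¹ := by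
        rw [← div_eq_mul_inv, div_le_div_iff₀ (by positivity) hq]
        have : (x - w.re) ^ 2 + ρ ^ 2 ≤ 2 * ‖z - w‖ ^ 2 := by linarith
        nlinarith [sq_nonneg K]
      have h5 : ‖F z‖ ^ 2 ≤ 2 * ‖G z‖ ^ 2 / ‖z - w‖ ^ 2 + 2 * K ^ 2 / ‖z - w‖ ^ 2 := by
        rw [← add_div, le_div_iff₀ (by positivity)]
        linarith
      have h6 : 0 ≤ M ^ 2 * (2 * ρ ^ 2) * ((x - w.re) ^ 2 + ρ ^ 2)⁻¹ := by positivity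
      linarith
  have hA0 : 0 ≤ A := by positivity
  refine ⟨hF, lt_of_le_of_lt (iSup₂_le fun y hy => ?_) (ENNReal.add_lt_top.2
    ⟨ENNReal.mul_lt_top (ENNReal.ofReal_lt_top (r := 2 / ρ ^ 2)) hG.2,
      ENNReal.ofReal_lt_top (r := A * (Real.pi / ρ))⟩)⟩
  calc ∫⁻ x : ℝ, ‖F ((x : ℂ) + (y : ℂ) * Complex.I)‖ₑ ^ 2
      ≤ ∫⁻ x : ℝ, (ENNReal.ofReal (2 / ρ ^ 2) * ‖G ((x : ℂ) + (y : ℂ) * Complex.I)‖ₑ ^ 2 +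
          ENNReal.ofReal (A * (‖(x : ℂ) - w'‖ ^ 2)⁻¹)) := by
        refine lintegral_mono fun x => ?_
        have h1 := ENNReal.ofReal_le_ofReal (key x y hy)
        rwa [ENNReal.ofReal_add (by positivity) (by positivity),
          ENNReal.ofReal_mul (p := 2 / ρ ^ 2) (by positivity),
          ENNReal.ofReal_pow (norm_nonneg _), ofReal_norm, ENNReal.ofReal_pow (norm_nonneg _),
          ofReal_norm] at h1
    _ = ENNReal.ofReal (2 / ρ ^ 2) * (∫⁻ x : ℝ, ‖G ((x : ℂ) + (y : ℂ) * Complex.I)‖ₑ ^ 2) +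
          ENNReal.ofReal (A * (Real.pi / ρ)) := by
        rw [lintegral_add_left (((hG.continuous_line hy).measurable.enorm.pow_const 2).const_mul _),
          lintegral_const_mul' _ _ ENNReal.ofReal_ne_top,
          ← ofReal_integral_eq_lintegral_ofReal ((integrable_inv_norm_sq hw'0).const_mul A)
            (Eventually.of_forall fun x => by positivity),
          integral_const_mul, integral_inv_norm_sq hw'0, hw'im]
    _ ≤ _ := by
        gcongr
        exact le_iSup₂ (f := fun (y : ℝ) (_ : 0 < y) =>
            ∫⁻ x : ℝ, ‖G ((x : ℂ) + (y : ℂ) * Complex.I)‖ₑ ^ 2) y hy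

namespace HermiteBiehler

variable {e : HermiteBiehler}

/-! ### The functions `s_β` and the relations they define -/

theorem differentiable_s (e : HermiteBiehler) (β : ℝ) : Differentiable ℂ (e.s β) := by
  have h1 := e.differentiable
  have h2 := e.differentiable.sharp
  unfold s
  fun_prop

theorem sharp_s (e : HermiteBiehler) (β : ℝ) : sharp (e.s β) = e.s β := by
  funext z
  simp only [sharp, s, map_mul, map_sub, map_div₀, Complex.conj_I, ← Complex.exp_conj, map_neg,
    Complex.conj_ofReal, Complex.conj_conj, map_ofNat]
  ring_nf

theorem conj_s_ofReal (e : HermiteBiehler) (β x : ℝ) : conj (e.s β x) = e.s β x := by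
  rw [← sharp_ofReal, sharp_s]

theorem norm_sharp_lt {z : ℂ} (hz : 0 < z.im) : ‖sharp e z‖ < ‖e z‖ := by
  simpa [sharp] using e.norm_conj_lt z hz

theorem norm_exp_I_mul (β : ℝ) : ‖Complex.exp (Complex.I * β)‖ = 1 := by
  rw [mul_comm, Complex.norm_exp_ofReal_mul_I]

theorem norm_exp_neg_I_mul (β : ℝ) : ‖Complex.exp (-(Complex.I * β))‖ = 1 := by
  rw [Complex.exp_neg, norm_inv, norm_exp_I_mul, inv_one]

theorem norm_s_le (β : ℝ) {z : ℂ} (hz : 0 < z.im) : ‖e.s β z‖ ≤ ‖e z‖ := by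
  have h := norm_sub_le (Complex.exp (Complex.I * β) * e z)
    (Complex.exp (-(Complex.I * β)) * sharp e z)
  rw [norm_mul, norm_mul, norm_exp_I_mul, norm_exp_neg_I_mul] at h
  rw [s, norm_mul, norm_div, Complex.norm_I, Complex.norm_two]
  linarith [norm_sharp_lt (e := e) hz]

theorem s_ne_zero (β : ℝ) {z : ℂ} (hz : z.im ≠ 0) : e.s β z ≠ 0 := by
  have hpos : ∀ z : ℂ, 0 < z.im → e.s β z ≠ 0 := by
    intro z hz h0
    have h := norm_sub_norm_le (Complex.exp (Complex.I * β) * e z)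
      (Complex.exp (-(Complex.I * β)) * sharp e z)
    have h1 : Complex.exp (Complex.I * β) * e z -
        Complex.exp (-(Complex.I * β)) * sharp e z = 0 := by
      rw [s] at h0
      exact (mul_eq_zero.1 h0).resolve_left (by simp)
    rw [h1, norm_mul, norm_mul, norm_exp_I_mul, norm_exp_neg_I_mul, norm_zero] at h
    linarith [norm_sharp_lt (e := e) hz]
  rcases lt_or_gt_of_ne hz with h | h
  · intro h0
    refine hpos (conj z) (by simpa using h) ?_
    have := congrFun (e.sharp_s β) z
    rw [h0, sharp] at this
    simpa using this
  · exact hpos z h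

theorem s_eq (e : HermiteBiehler) (β : ℝ) (z : ℂ) :
    e.s β z = Complex.exp (-(Complex.I * β)) * e.s 0 z - Real.sin β * e z := by
  have h1 : (Real.sin β : ℂ) =
      (Complex.exp (-(Complex.I * β)) - Complex.exp (Complex.I * β)) * Complex.I / 2 := by
    rw [Complex.ofReal_sin, Complex.sin, mul_comm Complex.I, neg_mul]
  rw [h1]
  simp only [s, Complex.ofReal_zero, mul_zero, neg_zero, Complex.exp_zero, one_mul]
  ring

variable (e) in
/-- The linear relation of all pairs `(g, h)` in `B(e)` for which `h(z) - z g(z)` is a multiple of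
`s_β`. It is the graph of `S_β`, without reference to the point `w` of the definition. -/
def relation (β : ℝ) : Submodule ℂ (e.Space × e.Space) where
  carrier := {p | ∃ c : ℂ, ∀ z, p.2 z = z * p.1 z + c * e.s β z}
  zero_mem' := ⟨0, fun z => by simp [Space.zero_apply]⟩
  add_mem' := by
    rintro p q ⟨c, hc⟩ ⟨d, hd⟩
    refine ⟨c + d, fun z => ?_⟩
    rw [Prod.snd_add, Prod.fst_add, Space.add_apply, Space.add_apply, hc, hd]
    ring
  smul_mem' := by
    rintro a p ⟨c, hc⟩
    refine ⟨a * c, fun z => ?_⟩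
    rw [Prod.smul_snd, Prod.smul_fst, Space.smul_apply, Space.smul_apply, hc]
    ring

theorem coe_relation {β : ℝ} (hβ : Real.sin β ≠ 0) :
    (e.relation β : Set (e.Space × e.Space)) = e.extensionGraph β := by
  have hβ' : (Real.sin β : ℂ) ≠ 0 := by exact_mod_cast hβ
  ext ⟨g, h⟩
  constructor
  · rintro ⟨c, hc⟩
    -- Any point `w` with `s_β(w) ≠ 0` will do.
    have hs : e.s β Complex.I ≠ 0 := s_ne_zero β (by simp)
    have hfw : ((Real.sin β : ℂ) / e.s β Complex.I) * (h Complex.I - Complex.I * g Complex.I) =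
        c * Real.sin β := by
      have := hc Complex.I
      simp only at this
      rw [this]
      field_simp
      ring
    have hf : ∀ z, (((Real.sin β : ℂ) / e.s β Complex.I) • (h - Complex.I • g)) z =
        ((Real.sin β : ℂ) / e.s β Complex.I) * (h z - Complex.I * g z) := fun z => rfl
    refine ⟨((Real.sin β : ℂ) / e.s β Complex.I) • (h - Complex.I • g), Complex.I,
      fun z hz => ?_, fun z => ?_⟩
    · have hz' := sub_ne_zero.2 hz
      have h2 := hc z
      simp only at h2 ⊢
      rw [hf, hf, hfw, h2]
      field_simp
      ring
    · rw [hf, hfw, hc z]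
      field_simp
  · rintro ⟨f, w, -, h2⟩
    exact ⟨1 / (Real.sin β : ℂ) * f w, h2⟩

/-- Off the real line, `S_β - w` is onto. -/
theorem exists_resolvent (β : ℝ) {w : ℂ} (hw : w.im ≠ 0) (f : e.Space) :
    ∃ g h : e.Space, (∀ z, h z = z * g z + f w / e.s β w * e.s β z) ∧ h - w • g = f := by
  set q := f w / e.s β w with hq
  set N : ℂ → ℂ := fun z => f z - q * e.s β z with hN
  have hNw : N w = 0 := by
    simp only [hN, hq]
    rw [div_mul_cancel₀ _ (s_ne_zero β hw), sub_self]
  have hNd : Differentiable ℂ N := f.differentiable.sub ((e.differentiable_s β).const_mul q)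
  set g := dslope N w with hg
  have hgd : Differentiable ℂ g := by
    rw [← differentiableOn_univ]
    exact (Complex.differentiableOn_dslope univ_mem).2 hNd.differentiableOn
  have hgN : ∀ z, (z - w) * g z = f z - q * e.s β z := by
    intro z
    have := sub_smul_dslope N w z
    rwa [hNw, sub_zero, smul_eq_mul] at this
  have hbd : ∀ (a : ℂ) (z : ℂ), 0 < z.im → ‖-(a * e.s β z / e z)‖ ≤ ‖a‖ := by
    intro a z hz
    rw [norm_neg, norm_div, norm_mul, div_le_iff₀ (norm_pos_iff.2 (ne_zero hz))]
    gcongr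
    exact norm_s_le β hz
  have hmem : g ∈ e.functions := by
    refine ⟨hgd, ?_, ?_⟩
    · refine IsHardyH2.of_sub_mul_eq (b := fun z => -(q * e.s β z / e z)) hw
        (hgd.differentiableOn.div e.differentiable.differentiableOn fun z hz => ne_zero hz)
        f.mem.2.1 (hbd q) fun z hz => ?_
      rw [← mul_div_assoc, hgN, sub_div]
      ring
    · refine IsHardyH2.of_sub_mul_eq (w := conj w) (b := fun z => -(conj q * e.s β z / e z))
        (by simpa using hw)
        (hgd.sharp.differentiableOn.div e.differentiable.differentiableOn fun z hz => ne_zero hz)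
        f.mem.2.2 (hbd (conj q)) fun z hz => ?_
      have h1 : (z - conj w) * sharp g z = sharp f z - conj q * e.s β z := by
        have h2 := congrArg conj (hgN (conj z))
        have h3 := congrFun (e.sharp_s β) z
        simp only [sharp] at h3 ⊢
        simpa [h3] using h2
      rw [← mul_div_assoc, h1, sub_div]
      ring
  refine ⟨Space.mk g hmem, w • Space.mk g hmem + f, fun z => ?_, by abel⟩
  rw [Space.add_apply, Space.smul_apply, Space.coe_mk]
  linear_combination -(hgN z)

/-! ### Symmetry -/

/-- The integral of `s_β u / |e|²` is computed from the behaviour of `u` along the imaginary axis: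
on the real line `s_β / |e|²` equals `(i/2) (e^{iβ} / e^# - e^{-iβ} / e)`, and the Poisson formula
applies to `u / e` and `u^# / e` after multiplication by `y² / (x² + y²)`. -/
theorem integral_s_mul_eq (β : ℝ) (u : e.Space) {a b : ℂ}
    (hint : Integrable fun x : ℝ => e.s β x * u x / ((‖e x‖ ^ 2 : ℝ) : ℂ))
    (ha : Tendsto (fun y : ℝ => y * (u (y * Complex.I) / e (y * Complex.I))) atTop (𝓝 a))
    (hb : Tendsto (fun y : ℝ => y * (u.sharp (y * Complex.I) / e (y * Complex.I))) atTop (𝓝 b)) :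
    ∫ x : ℝ, e.s β x * u x / ((‖e x‖ ^ 2 : ℝ) : ℂ) = Complex.I * Real.pi / 2 *
      (Complex.exp (Complex.I * β) * conj b - Complex.exp (-(Complex.I * β)) * a) := by
  set p : ℝ → ℝ → ℝ := fun y x => (‖(x : ℂ) - y * Complex.I‖ ^ 2)⁻¹ with hp
  have hpx : ∀ y x : ℝ, p y x = (x ^ 2 + y ^ 2)⁻¹ := by
    intro y x
    simp only [hp]
    rw [norm_ofReal_sub_sq]
    simp
  have h1 : Tendsto (fun y : ℝ => ∫ x : ℝ, ((y ^ 2 * p y x : ℝ) : ℂ) *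
      (e.s β x * u x / ((‖e x‖ ^ 2 : ℝ) : ℂ))) atTop
      (𝓝 (∫ x : ℝ, e.s β x * u x / ((‖e x‖ ^ 2 : ℝ) : ℂ))) := by
    refine tendsto_integral_filter_of_dominated_convergence _ ?_ ?_ hint.norm ?_
    · filter_upwards [eventually_gt_atTop 0] with y hy
      refine AEStronglyMeasurable.mul (Continuous.aestronglyMeasurable ?_) hint.1
      exact Complex.continuous_ofReal.comp
        ((continuous_inv_norm_sq (by simpa using hy)).const_mul _)
    · filter_upwards [eventually_gt_atTop 0] with y hy
      refine Eventually.of_forall fun x => ?_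
      rw [norm_mul, Complex.norm_real, hpx, Real.norm_of_nonneg (by positivity)]
      refine mul_le_of_le_one_left (norm_nonneg _) ?_
      rw [← div_eq_mul_inv, div_le_one (by positivity)]
      linarith [sq_nonneg x]
    · refine Eventually.of_forall fun x => ?_
      have h2 : Tendsto (fun y : ℝ => y ^ 2 * p y x) atTop (𝓝 1) := by
        have h3 : Tendsto (fun y : ℝ => 1 - x ^ 2 / (x ^ 2 + y ^ 2)) atTop (𝓝 (1 - 0)) := by
          refine Tendsto.const_sub _ (tendsto_const_nhds.div_atTop ?_)
          exact tendsto_atTop_add_const_left _ _ (tendsto_pow_atTop two_ne_zero)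
        rw [sub_zero] at h3
        refine h3.congr' ?_
        filter_upwards [eventually_gt_atTop 0] with y hy
        rw [hpx]
        have : x ^ 2 + y ^ 2 ≠ 0 := by positivity
        field_simp
        ring
      have h4 := ((Complex.continuous_ofReal.tendsto _).comp h2).mul_const
        (e.s β x * u x / ((‖e x‖ ^ 2 : ℝ) : ℂ))
      simpa using h4
  refine tendsto_nhds_unique h1 ?_
  have h2 : Tendsto (fun y : ℝ => Complex.I * Real.pi / 2 * (Complex.exp (Complex.I * β) *
      conj (y * (u.sharp (y * Complex.I) / e (y * Complex.I))) -
      Complex.exp (-(Complex.I * β)) * (y * (u (y * Complex.I) / e (y * Complex.I))))) atTop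
      (𝓝 (Complex.I * Real.pi / 2 *
      (Complex.exp (Complex.I * β) * conj b - Complex.exp (-(Complex.I * β)) * a))) :=
    ((((Complex.continuous_conj.tendsto _).comp hb).const_mul _).sub (ha.const_mul _)).const_mul _
  refine h2.congr' ?_
  filter_upwards [eventually_gt_atTop 0] with y hy
  have hyI : 0 < ((y : ℂ) * Complex.I).im := by simpa using hy
  have hP1 := integral_poisson u hyI
  have hP2 := congrArg conj (integral_poisson u.sharp hyI)
  rw [← integral_conj] at hP2
  have hi1 : Integrable fun x : ℝ => u x / e x * ((p y x : ℝ) : ℂ) :=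
    (memLp_div u).integrable_mul (memLp_inv_norm_sq hyI)
  have hi2 : Integrable fun x : ℝ => conj (u.sharp x / e x * ((p y x : ℝ) : ℂ)) := by
    have := ((memLp_div u.sharp).integrable_mul (memLp_inv_norm_sq hyI))
    exact (Complex.conjCLE : ℂ →L[ℝ] ℂ).integrable_comp this
  have hae : ∀ᵐ x : ℝ, ((y ^ 2 * p y x : ℝ) : ℂ) * (e.s β x * u x / ((‖e x‖ ^ 2 : ℝ) : ℂ)) =
      Complex.I / 2 * y ^ 2 * (Complex.exp (Complex.I * β) *
        conj (u.sharp x / e x * ((p y x : ℝ) : ℂ)) -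
        Complex.exp (-(Complex.I * β)) * (u x / e x * ((p y x : ℝ) : ℂ))) := by
    filter_upwards [ae_real_ne_zero (e := e)] with x hx
    have hx' : conj (e x) ≠ 0 := by simpa using hx
    rw [← Complex.normSq_eq_norm_sq, ← Complex.mul_conj, map_mul, map_div₀,
      Space.sharp_ofReal_apply, Complex.conj_conj, Complex.conj_ofReal, s, sharp_ofReal]
    push_cast
    field_simp
  rw [integral_congr_ae hae, integral_const_mul, integral_sub (hi2.const_mul _) (hi1.const_mul _),
    integral_const_mul, integral_const_mul]
  simp only [hp]
  rw [hP2, hP1]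
  have hyc : (y : ℂ) ≠ 0 := by exact_mod_cast hy.ne'
  have him : ((y : ℂ) * Complex.I).im = y := by simp
  simp only [map_mul, map_div₀, Complex.conj_ofReal, him]
  field_simp

theorem Space.sharp_relation {β : ℝ} {g h : e.Space} {c : ℂ}
    (hc : ∀ z, h z = z * g z + c * e.s β z) (z : ℂ) :
    h.sharp z = z * g.sharp z + conj c * e.s β z := by
  have h1 := congrArg conj (hc (conj z))
  have h3 := congrFun (e.sharp_s β) z
  simp only [Space.coe_sharp, _root_.sharp] at h3 ⊢
  rw [h1, map_add, map_mul, map_mul, h3, Complex.conj_conj]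

theorem tendsto_mul_div_of_mul_eq {u v : e.Space} (h : ∀ z, v z = z * u z) :
    Tendsto (fun y : ℝ => y * (u (y * Complex.I) / e (y * Complex.I))) atTop (𝓝 0) := by
  have h1 := (tendsto_div_imaginary_axis v).const_mul (-Complex.I)
  rw [mul_zero] at h1
  refine h1.congr fun y => ?_
  rw [h]
  linear_combination (-(y : ℂ) * (u (y * Complex.I) / e (y * Complex.I))) * Complex.I_mul_I

theorem relation_symmetric {β : ℝ} {g h g' h' : e.Space} (H : (g, h) ∈ e.relation β)
    (H' : (g', h') ∈ e.relation β) : inner ℂ h g' = inner ℂ g h' := by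
  obtain ⟨c, hc⟩ := H
  obtain ⟨c', hc'⟩ := H'
  -- The boundary term of `⟨h, g'⟩ - ⟨g, h'⟩` is carried by `u`, and `z u(z)` is again in the space.
  set u : e.Space := conj c • g' - c' • g.sharp with hu
  set v : e.Space := conj c • h' - c' • h.sharp with hv
  have huz : ∀ z, u z = conj c * g' z - c' * g.sharp z := fun z => rfl
  have hvu : ∀ z, v z = z * u z := by
    intro z
    have h1 : v z = conj c * h' z - c' * h.sharp z := rfl
    rw [h1, huz, Space.sharp_relation hc, hc' z]
    ring
  have hvu' : ∀ z, v.sharp z = z * u.sharp z := by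
    intro z
    have := Space.sharp_relation (β := β) (g := u) (h := v) (c := 0) (by simpa using hvu) z
    simpa using this
  have hdiff : ∀ x : ℝ, conj (h x) * g' x / ((‖e x‖ ^ 2 : ℝ) : ℂ) -
      conj (g x) * h' x / ((‖e x‖ ^ 2 : ℝ) : ℂ) = e.s β x * u x / ((‖e x‖ ^ 2 : ℝ) : ℂ) := by
    intro x
    rw [huz, Space.sharp_ofReal_apply, ← sub_div]
    have h1 := hc x
    have h2 := hc' x
    simp only at h1 h2
    rw [h1, h2, map_add, map_mul, map_mul, Complex.conj_ofReal, conj_s_ofReal]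
    ring
  have hi1 := integrable_integrand h g'
  have hi2 := integrable_integrand g h'
  have hi := hi1.sub hi2
  have h0 : inner ℂ h g' - inner ℂ g h' = 0 := by
    rw [inner_def, inner_def, ← integral_sub hi1 hi2]
    simp only [hdiff]
    rw [integral_s_mul_eq β u (a := 0) (b := 0) (hi.congr (Eventually.of_forall hdiff))
      (tendsto_mul_div_of_mul_eq hvu) (tendsto_mul_div_of_mul_eq hvu')]
    simp
  exact sub_eq_zero.1 h0

theorem tendsto_s_div (hs : e.s 0 ∈ e.functions) (β : ℝ) :
    Tendsto (fun y : ℝ => e.s β (y * Complex.I) / e (y * Complex.I)) atTop (𝓝 (-Real.sin β)) := by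
  have h1 := ((tendsto_div_imaginary_axis (Space.mk _ hs)).const_mul
    (Complex.exp (-(Complex.I * β)))).sub_const (Real.sin β : ℂ)
  rw [mul_zero, zero_sub] at h1
  refine h1.congr' ?_
  filter_upwards [eventually_gt_atTop 0] with y hy
  have : e (y * Complex.I) ≠ 0 := ne_zero (by simpa using hy)
  rw [s_eq, Space.coe_mk, sub_div, mul_div_cancel_right₀ _ this, mul_div_assoc]

/-- The coefficient `c` of a pair `(g, h)` in the relation is, up to a constant, the scalar product
of `g` with `s_0`. -/
theorem inner_s_zero (hs : e.s 0 ∈ e.functions) {β : ℝ} {g h : e.Space} {c : ℂ}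
    (hc : ∀ z, h z = z * g z + c * e.s β z) :
    inner ℂ (Space.mk (e.s 0) hs) g = -(Real.pi * Real.sin β) * c := by
  have hlim : ∀ {g h : e.Space} {c : ℂ}, (∀ z, h z = z * g z + c * e.s β z) →
      Tendsto (fun y : ℝ => y * (g (y * Complex.I) / e (y * Complex.I))) atTop
        (𝓝 (-Complex.I * (0 - c * (-Real.sin β)))) := by
    intro g h c hc
    refine (((tendsto_div_imaginary_axis h).sub ((tendsto_s_div hs β).const_mul c)).const_mul
      (-Complex.I)).congr fun y => ?_
    rw [hc]
    linear_combination (-(y : ℂ) * (g (y * Complex.I) / e (y * Complex.I))) * Complex.I_mul_I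
  have hint := integrable_integrand (Space.mk (e.s 0) hs) g
  rw [inner_def]
  simp only [Space.coe_mk, conj_s_ofReal] at hint ⊢
  rw [integral_s_mul_eq 0 g hint (hlim hc) (hlim (Space.sharp_relation hc))]
  simp only [Complex.ofReal_zero, mul_zero, neg_zero, Complex.exp_zero, one_mul, map_mul, map_sub,
    map_neg, Complex.conj_I, Complex.conj_conj, Complex.conj_ofReal, map_zero]
  linear_combination (Real.pi * Real.sin β * c) * Complex.I_mul_I

end HermiteBiehler

/-! ### Symmetric operators with full resolvent ranges -/

section OperatorTheory

variable {H : Type*} [NormedAddCommGroup H] [InnerProductSpace ℂ H]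

theorem IsSelfAdjointOperator.of_symmetric [CompleteSpace H] {A : H →ₗ.[ℂ] H}
    (hsym : ∀ p ∈ A.graph, ∀ q ∈ A.graph, inner ℂ p.2 q.1 = inner ℂ p.1 q.2)
    (hres : ∀ w : ℂ, w.im ≠ 0 → ∀ f, ∃ p ∈ A.graph, p.2 - w • p.1 = f) :
    IsSelfAdjointOperator A := by
  have hadj : A.graph.adjoint = A.graph := by
    apply le_antisymm
    · intro x hx
      rw [Submodule.mem_adjoint_iff] at hx
      obtain ⟨p, hp, hpx⟩ := hres Complex.I (by simp) (x.2 - Complex.I • x.1)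
      obtain ⟨q, hq, hqx⟩ := hres (-Complex.I) (by simp) (x.1 - p.1)
      have h2 : x.2 - p.2 = Complex.I • (x.1 - p.1) := by
        rw [smul_sub, sub_eq_sub_iff_add_eq_add]
        have := sub_eq_sub_iff_add_eq_add.1 hpx
        rw [← this]
        abel
      -- `x - p` lies in the adjoint, so its first component is orthogonal to the range of `A + i`.
      have h3 : inner ℂ q.2 (x.1 - p.1) - inner ℂ q.1 (x.2 - p.2) = 0 := by
        have h4 := hx q.1 q.2 hq
        have h5 := hsym q hq p hp
        rw [inner_sub_right, inner_sub_right]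
        linear_combination h4 - h5
      have h6 : inner ℂ (x.1 - p.1) (x.1 - p.1) = 0 := by
        have h7 : inner ℂ (q.2 - (-Complex.I) • q.1) (x.1 - p.1) = 0 := by
          rw [inner_sub_left, inner_smul_left]
          rw [h2, inner_smul_right] at h3
          rw [map_neg, Complex.conj_I, neg_neg]
          exact h3
        rwa [hqx] at h7
      have h8 : x.1 - p.1 = 0 := inner_self_eq_zero.1 h6
      rw [h8, smul_zero] at h2
      have : x = p := Prod.ext (sub_eq_zero.1 h8) (sub_eq_zero.1 h2)
      rwa [this]
    · intro p hp
      rw [Submodule.mem_adjoint_iff]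
      intro a b hab
      exact sub_eq_zero.2 (hsym _ hab p hp)
  refine ⟨?_, hadj⟩
  rw [Submodule.dense_iff_topologicalClosure_eq_top, Submodule.topologicalClosure_eq_top_iff,
    Submodule.eq_bot_iff]
  intro x hx
  have h1 : ((0 : H), x) ∈ A.graph.adjoint := by
    rw [Submodule.mem_adjoint_iff]
    intro a b hab
    have := (Submodule.mem_orthogonal _ _).1 hx a (LinearPMap.mem_domain_of_mem_graph hab)
    simp [this]
  rw [hadj] at h1
  exact A.graph_fst_eq_zero_snd h1 rfl

/-- The resolvent estimate `‖(A - w)⁻¹‖ ≤ 1 / |Im w|`. -/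
theorem abs_im_mul_norm_le_of_symmetric {A : H →ₗ.[ℂ] H}
    (hsym : ∀ p ∈ A.graph, ∀ q ∈ A.graph, inner ℂ p.2 q.1 = inner ℂ p.1 q.2)
    {p : H × H} (hp : p ∈ A.graph) (w : ℂ) : |w.im| * ‖p.1‖ ≤ ‖p.2 - w • p.1‖ := by
  have h1 : (inner ℂ p.1 p.2).im = 0 := by
    have h := hsym p hp p hp
    rw [← inner_conj_symm] at h
    exact Complex.conj_eq_iff_im.1 h
  have h2 : (inner ℂ p.1 (p.2 - w • p.1)).im = -(w.im * ‖p.1‖ ^ 2) := by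
    rw [inner_sub_right, inner_smul_right, Complex.sub_im, h1, inner_self_eq_norm_sq_to_K,
      zero_sub]
    congr 1
    have : ((‖p.1‖ : ℂ)) ^ 2 = ((‖p.1‖ ^ 2 : ℝ) : ℂ) := by push_cast; rfl
    simp only [Complex.coe_algebraMap]
    rw [this, Complex.im_mul_ofReal]
  have h3 : |w.im| * ‖p.1‖ ^ 2 ≤ ‖p.1‖ * ‖p.2 - w • p.1‖ := by
    have h4 := (Complex.abs_im_le_norm _).trans (norm_inner_le_norm (𝕜 := ℂ) p.1 (p.2 - w • p.1))
    rwa [h2, abs_neg, abs_mul, abs_of_nonneg (sq_nonneg ‖p.1‖)] at h4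
  rcases (norm_nonneg p.1).eq_or_lt with h | h
  · rw [← h, mul_zero]
    exact norm_nonneg _
  · refine le_of_mul_le_mul_left ?_ h
    linarith

/-- If `f` is orthogonal to the kernel of `A - t`, the resolvents `(A - t - iy)⁻¹ f` are `o(1 / y)`
as `y → 0`. -/
theorem eventually_mul_norm_le_of_orthogonal [CompleteSpace H] {A : H →ₗ.[ℂ] H}
    (hA : A.graph.adjoint = A.graph) {t : ℝ} {f : H}
    (hf : ∀ v, (v, (t : ℂ) • v) ∈ A.graph → inner ℂ v f = 0) {δ : ℝ} (hδ : 0 < δ) :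
    ∀ᶠ y : ℝ in 𝓝[>] 0, ∀ p ∈ A.graph, p.2 - (t + y * Complex.I) • p.1 = f →
      y * ‖p.1‖ ≤ δ := by
  have hsym : ∀ p ∈ A.graph, ∀ q ∈ A.graph, inner ℂ p.2 q.1 = inner ℂ p.1 q.2 := by
    intro p hp q hq
    rw [← hA, Submodule.mem_adjoint_iff] at hq
    exact sub_eq_zero.1 (hq p.1 p.2 hp)
  set R : Submodule ℂ H := A.graph.map (LinearMap.snd ℂ H H - (t : ℂ) • LinearMap.fst ℂ H H) with hR
  have hfR : f ∈ R.topologicalClosure := by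
    rw [← Submodule.orthogonal_orthogonal_eq_closure, Submodule.mem_orthogonal]
    intro v hv
    refine hf v ?_
    rw [← hA, Submodule.mem_adjoint_iff]
    intro a b hab
    have h1 := (Submodule.mem_orthogonal _ _).1 hv _ (Submodule.mem_map_of_mem hab)
    simp only [LinearMap.sub_apply, LinearMap.snd_apply, LinearMap.smul_apply,
      LinearMap.fst_apply] at h1
    rw [inner_sub_left, inner_smul_left, Complex.conj_ofReal] at h1
    rwa [inner_smul_right]
  obtain ⟨_, ⟨q, hq, rfl⟩, hqf⟩ := Metric.mem_closure_iff.1 hfR (δ / 2) (by positivity)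
  simp only [LinearMap.sub_apply, LinearMap.snd_apply, LinearMap.smul_apply,
      LinearMap.fst_apply] at hqf
  have hev : ∀ᶠ y : ℝ in 𝓝[>] 0, 2 * y * ‖q.1‖ < δ / 2 := by
    have h1 : Tendsto (fun y : ℝ => 2 * y * ‖q.1‖) (𝓝 0) (𝓝 0) := by
      have : Continuous fun y : ℝ => 2 * y * ‖q.1‖ := by fun_prop
      exact this.tendsto' 0 0 (by simp)
    exact (h1.mono_left nhdsWithin_le_nhds).eventually (gt_mem_nhds (by positivity))
  filter_upwards [hev, self_mem_nhdsWithin] with y hy hy0 p hp hpf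
  have hy0' : 0 < y := hy0
  have h1 := abs_im_mul_norm_le_of_symmetric hsym (A.graph.sub_mem hp hq) (t + y * Complex.I)
  have h2 : (p - q).2 - ((t : ℂ) + y * Complex.I) • (p - q).1 =
      (f - (q.2 - (t : ℂ) • q.1)) + (y * Complex.I) • q.1 := by
    rw [← hpf, Prod.snd_sub, Prod.fst_sub, smul_sub, add_smul, add_smul]
    abel
  have him : ((t : ℂ) + y * Complex.I).im = y := by simp
  have h3 : ‖((y : ℂ) * Complex.I) • q.1‖ = y * ‖q.1‖ := by
    rw [norm_smul, norm_mul, Complex.norm_I, mul_one, Complex.norm_real,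
      Real.norm_of_nonneg hy0'.le]
  rw [h2, him, abs_of_pos hy0', Prod.fst_sub] at h1
  have h4 := norm_add_le (f - (q.2 - (t : ℂ) • q.1)) (((y : ℂ) * Complex.I) • q.1)
  rw [dist_eq_norm] at hqf
  have h5 : ‖p.1‖ ≤ ‖p.1 - q.1‖ + ‖q.1‖ := by
    simpa using norm_add_le (p.1 - q.1) q.1
  nlinarith

/-! ### Resolution of the identity of an operator with an eigenbasis -/

namespace HilbertBasis

variable {ι : Type*} (b : HilbertBasis ι ℂ H)

theorem eq_of_inner_eq {x y : H} (h : ∀ i, inner ℂ (b i) x = inner ℂ (b i) y) : x = y := by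
  refine b.repr.injective (lp.ext (funext fun i => ?_))
  rw [b.repr_apply_apply, b.repr_apply_apply, h]

theorem inner_mul_inner_eq (x y : H) :
    inner ℂ x y * inner ℂ y x = ((‖inner ℂ y x‖ ^ 2 : ℝ) : ℂ) := by
  rw [← inner_conj_symm x y, Complex.conj_mul']
  push_cast
  rfl

theorem hasSum_inner_smul (x : H) : HasSum (fun i => inner ℂ (b i) x • b i) x := by
  simpa only [b.repr_apply_apply] using b.hasSum_repr x

variable [CompleteSpace H]

/-- The orthogonal projection onto the closed span of the basis vectors with index in `S`,
described as the orthogonal complement of the other basis vectors. -/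
noncomputable def proj (S : Set ι) : H →L[ℂ] H := (Submodule.span ℂ (b '' Sᶜ))ᗮ.starProjection

theorem inner_proj_of_mem {S : Set ι} {i : ι} (hi : i ∈ S) (x : H) :
    inner ℂ (b i) (b.proj S x) = inner ℂ (b i) x := by
  rw [proj, ← Submodule.inner_starProjection_left_eq_right, Submodule.starProjection_eq_self_iff.2]
  refine (Submodule.mem_orthogonal' _ _).2 fun u hu => ?_
  refine Submodule.span_induction (p := fun u _ => inner ℂ (b i) u = 0) ?_ (inner_zero_right _)
    (fun u v _ _ hu hv => by rw [inner_add_right, hu, hv, add_zero])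
    (fun c u _ hu => by rw [inner_smul_right, hu, mul_zero]) hu
  rintro _ ⟨j, hj, rfl⟩
  exact b.orthonormal.2 fun hij => hj (hij ▸ hi)

theorem inner_proj_of_notMem {S : Set ι} {i : ι} (hi : i ∉ S) (x : H) :
    inner ℂ (b i) (b.proj S x) = 0 :=
  (Submodule.mem_orthogonal _ _).1 (Submodule.starProjection_apply_mem _ x) _
    (Submodule.subset_span ⟨i, hi, rfl⟩)

theorem hasSum_proj_coe (S : Set ι) (x : H) :
    HasSum (fun i : S => inner ℂ (b i) x • b i) (b.proj S x) := by
  have h := b.hasSum_inner_smul (b.proj S x)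
  have h1 : (fun i => inner ℂ (b i) (b.proj S x) • b i) =
      S.indicator fun i => inner ℂ (b i) x • b i := by
    funext i
    by_cases hi : i ∈ S
    · rw [Set.indicator_of_mem hi, b.inner_proj_of_mem hi]
    · rw [Set.indicator_of_notMem hi, b.inner_proj_of_notMem hi, zero_smul]
  rw [h1] at h
  exact hasSum_subtype_iff_indicator.2 h

/-- The projection-valued measure which assigns to `t` the projection onto the closed span of the
basis vectors `b i` with `a i ∈ t`. -/
noncomputable def projectionValuedMeasure (a : ι → ℝ) : ProjectionValuedMeasure H where
  proj t := b.proj (a ⁻¹' t)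
  isProjection t _ := Submodule.isSymmetricProjection_starProjection _
  proj_univ := by
    ext x
    exact b.eq_of_inner_eq fun i => b.inner_proj_of_mem (Set.mem_univ _) x
  proj_inter t u _ _ := by
    ext x
    refine b.eq_of_inner_eq fun i => ?_
    rw [ContinuousLinearMap.comp_apply]
    by_cases ht : i ∈ a ⁻¹' t
    · rw [b.inner_proj_of_mem ht]
      by_cases hu : i ∈ a ⁻¹' u
      · rw [b.inner_proj_of_mem hu, b.inner_proj_of_mem (S := a ⁻¹' (t ∩ u)) ⟨ht, hu⟩]
      · rw [b.inner_proj_of_notMem hu, b.inner_proj_of_notMem (S := a ⁻¹' (t ∩ u)) fun h => hu h.2]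
    · rw [b.inner_proj_of_notMem ht, b.inner_proj_of_notMem (S := a ⁻¹' (t ∩ u)) fun h => ht h.1]
  hasSum_proj t _ hd x := by
    have hd' : Pairwise (Function.onFun Disjoint fun n => a ⁻¹' t n) := fun m n hmn =>
      (hd hmn).preimage a
    have h := b.hasSum_proj_coe (a ⁻¹' ⋃ n, t n) x
    rw [Set.preimage_iUnion] at h ⊢
    rw [← (Set.unionEqSigmaOfDisjoint hd').symm.hasSum_iff] at h
    exact h.sigma fun n => b.hasSum_proj_coe (a ⁻¹' t n) x

theorem projectionValuedMeasure_proj (a : ι → ℝ) (t : Set ℝ) :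
    (b.projectionValuedMeasure a).proj t = b.proj (a ⁻¹' t) := rfl

theorem scalarMeasure_eq_sum (a : ι → ℝ) (x : H) :
    (b.projectionValuedMeasure a).scalarMeasure x =
      Measure.sum fun i => ENNReal.ofReal (‖inner ℂ (b i) x‖ ^ 2) • Measure.dirac (a i) := by
  ext t ht
  rw [ProjectionValuedMeasure.scalarMeasure_apply _ _ ht, Measure.sum_apply _ ht,
    projectionValuedMeasure_proj]
  have h1 : HasSum (fun i => (a ⁻¹' t).indicator (fun i => ‖inner ℂ (b i) x‖ ^ 2) i)
      (inner ℂ x (b.proj (a ⁻¹' t) x)).re := by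
    have h2 := Complex.hasSum_re (b.hasSum_inner_mul_inner x (b.proj (a ⁻¹' t) x))
    convert h2 using 1
    funext i
    by_cases hi : i ∈ a ⁻¹' t
    · rw [Set.indicator_of_mem hi, b.inner_proj_of_mem hi, inner_mul_inner_eq, Complex.ofReal_re]
    · rw [Set.indicator_of_notMem hi, b.inner_proj_of_notMem hi, mul_zero, Complex.zero_re]
  rw [← h1.tsum_eq, ENNReal.ofReal_tsum_of_nonneg (fun i => Set.indicator_nonneg
    (fun i _ => by positivity) i) h1.summable]
  refine tsum_congr fun i => ?_
  rw [Measure.smul_apply, Measure.dirac_apply' _ ht, smul_eq_mul]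
  by_cases hi : a i ∈ t
  · rw [Set.indicator_of_mem (Set.mem_preimage.2 hi), Set.indicator_of_mem hi, Pi.one_apply,
      mul_one]
  · rw [Set.indicator_of_notMem (show i ∉ a ⁻¹' t from hi), Set.indicator_of_notMem hi, mul_zero,
      ENNReal.ofReal_zero]

theorem integrable_scalarMeasure_iff (a : ι → ℝ) (x : H) {f : ℝ → ℝ} (hf : Continuous f) :
    Integrable f ((b.projectionValuedMeasure a).scalarMeasure x) ↔
      Summable fun i => ‖inner ℂ (b i) x‖ ^ 2 * |f (a i)| := by
  rw [scalarMeasure_eq_sum]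
  constructor
  · intro h
    have := h.summable_integral
    simpa [integral_smul_measure] using this
  · intro h
    refine ⟨hf.aestronglyMeasurable, ?_⟩
    rw [HasFiniteIntegral, lintegral_sum_measure]
    refine lt_of_le_of_lt (le_of_eq (tsum_congr fun i => ?_)) h.tsum_ofReal_lt_top
    rw [lintegral_smul_measure, lintegral_dirac' _ hf.measurable.enorm, smul_eq_mul,
      ENNReal.ofReal_mul (by positivity), ← Real.norm_eq_abs, ofReal_norm]

/-- A self-adjoint operator with an eigenbasis is the integral of the identity function against the
projection-valued measure of the eigenbasis. -/
theorem isResolutionOfIdentity {A : H →ₗ.[ℂ] H} (hA : A.graph.adjoint = A.graph) {a : ι → ℝ}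
    (hb : ∀ i, (b i, (a i : ℂ) • b i) ∈ A.graph) :
    (b.projectionValuedMeasure a).IsResolutionOfIdentity A := by
  have hsym : ∀ i, ∀ p ∈ A.graph, inner ℂ (b i) p.2 = a i * inner ℂ (b i) p.1 := by
    intro i p hp
    rw [← hA, Submodule.mem_adjoint_iff] at hp
    have h1 := hp _ _ (hb i)
    rw [inner_smul_left, Complex.conj_ofReal, sub_eq_zero] at h1
    exact h1.symm
  have hdom : ∀ x, x ∈ A.domain ↔ Summable fun i => ‖inner ℂ (b i) x‖ ^ 2 * |a i ^ 2| := by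
    intro x
    have hterm : ∀ i, ‖(a i : ℂ) * inner ℂ (b i) x‖ ^ 2 = ‖inner ℂ (b i) x‖ ^ 2 * |a i ^ 2| := by
      intro i
      rw [norm_mul, mul_pow, Complex.norm_real, Real.norm_eq_abs, abs_pow, mul_comm]
    constructor
    · intro hx
      have h1 := b.orthonormal.inner_products_summable (A ⟨x, hx⟩)
      have h2 : ∀ i, inner ℂ (b i) (A ⟨x, hx⟩) = a i * inner ℂ (b i) x :=
        fun i => hsym i _ (A.mem_graph ⟨x, hx⟩)
      simpa only [h2, hterm] using h1
    · intro hx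
      have hmem : Memℓp (fun i => (a i : ℂ) * inner ℂ (b i) x) 2 := by
        rw [memℓp_gen_iff (by norm_num)]
        simpa only [ENNReal.toReal_ofNat, Real.rpow_ofNat, hterm] using hx
      set y : H := b.repr.symm ⟨_, hmem⟩ with hy
      have hyi : ∀ i, inner ℂ (b i) y = a i * inner ℂ (b i) x := by
        intro i
        rw [← b.repr_apply_apply, hy, LinearIsometryEquiv.apply_symm_apply]
      have hxy : (x, y) ∈ A.graph := by
        rw [← hA, Submodule.mem_adjoint_iff]
        intro g h hgh
        refine sub_eq_zero.2 ((b.hasSum_inner_mul_inner h x).unique ?_)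
        convert b.hasSum_inner_mul_inner g y using 1
        funext i
        have h1 := congrArg conj (hsym i _ hgh)
        simp only [map_mul, inner_conj_symm, Complex.conj_ofReal] at h1
        rw [h1, hyi]
        ring
      exact LinearPMap.mem_domain_of_mem_graph hxy
  refine ⟨fun x => ?_, fun x => ?_⟩
  · rw [b.integrable_scalarMeasure_iff a x (continuous_pow 2), hdom]
  · have hsq := (hdom x).1 x.2
    have hint : Integrable (fun t : ℝ => t) ((b.projectionValuedMeasure a).scalarMeasure x) := by
      refine (b.integrable_scalarMeasure_iff a x continuous_id).2 ?_
      refine Summable.of_nonneg_of_le (fun i => by positivity) (fun i => ?_)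
        ((b.orthonormal.inner_products_summable (x : H)).add hsq)
      have h1 : |id (a i)| ≤ 1 + |a i ^ 2| := by
        simp only [id, abs_pow]
        nlinarith [sq_nonneg (|a i| - 1), abs_nonneg (a i)]
      calc ‖inner ℂ (b i) (x : H)‖ ^ 2 * |id (a i)|
          ≤ ‖inner ℂ (b i) (x : H)‖ ^ 2 * (1 + |a i ^ 2|) := by gcongr
        _ = _ := by ring
    rw [scalarMeasure_eq_sum] at hint ⊢
    have h1 := Complex.hasSum_ofReal.2 (hasSum_integral_measure hint)
    have h3 := b.hasSum_inner_mul_inner (x : H) (A x)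
    refine h3.unique (Eq.subst (motive := fun u => HasSum u _) (funext fun i => ?_) h1)
    have h2 : inner ℂ (b i) (A x) = a i * inner ℂ (b i) (x : H) := hsym i _ (A.mem_graph x)
    rw [h2, mul_left_comm, inner_mul_inner_eq, integral_smul_measure, integral_dirac,
      ENNReal.toReal_ofReal (by positivity), smul_eq_mul]
    push_cast
    ring

/-- If the eigenvalues are pairwise distinct, a vector whose coordinates in the eigenbasis are all
nonzero is generating. The projection onto an eigenspace is recovered from intervals by
`{t} = [t, t + 1) \ ⋃ [t + 1 / (n + 2), t + 1 / (n + 1))`. -/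
theorem isGeneratingVector {A : H →ₗ.[ℂ] H} (hA : A.graph.adjoint = A.graph) {a : ι → ℝ}
    (ha : Function.Injective a) (hb : ∀ i, (b i, (a i : ℂ) • b i) ∈ A.graph) {g : H}
    (hg : ∀ i, inner ℂ (b i) g ≠ 0) : IsGeneratingVector A g := by
  refine ⟨b.projectionValuedMeasure a, b.isResolutionOfIdentity hA hb, ?_⟩
  set E := b.projectionValuedMeasure a with hE
  set V := Submodule.span ℂ {v : H | ∃ c d : ℝ, v = E.proj (Set.Ico c d) g} with hV
  have hIco : ∀ c d : ℝ, E.proj (Set.Ico c d) g ∈ V.topologicalClosure := fun c d =>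
    V.le_topologicalClosure (Submodule.subset_span ⟨c, d, rfl⟩)
  have hsingle : ∀ t : ℝ, E.proj {t} g ∈ V.topologicalClosure := by
    intro t
    set u : ℕ → ℝ := fun n => t + 1 / ((n : ℝ) + 1) with hu
    have hanti : StrictAnti u := by
      intro m n hmn
      simp only [hu]
      gcongr
    -- `D 0 = {t}`, and the other `D n` are the half-open intervals between consecutive `u k`.
    set D : ℕ → Set ℝ := fun n => n.casesOn {t} fun k => Set.Ico (u (k + 1)) (u k) with hD
    have hlt : ∀ n, t < u n := fun n => by
      simp only [hu]
      have : (0 : ℝ) < 1 / ((n : ℝ) + 1) := by positivity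
      linarith
    have hdisj : Pairwise (Function.onFun Disjoint D) := by
      rw [pairwise_disjoint_on]
      intro m n hmn
      rw [Set.disjoint_left]
      intro x hxm hxn
      obtain ⟨k, rfl⟩ : ∃ k, n = k + 1 := ⟨n - 1, by omega⟩
      have hxn' : x ∈ Set.Ico (u (k + 1)) (u k) := hxn
      rcases m with _ | m
      · have : x = t := hxm
        linarith [hlt (k + 1), hxn'.1]
      · have hxm' : x ∈ Set.Ico (u (m + 1)) (u m) := hxm
        have : u k ≤ u (m + 1) := hanti.antitone (by omega)
        linarith [hxn'.2, hxm'.1]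
    have hunion : ⋃ n, D n = Set.Ico t (u 0) := by
      ext x
      rw [Set.mem_iUnion]
      constructor
      · rintro ⟨_ | k, hx⟩
        · have : x = t := hx
          rw [this]
          exact ⟨le_rfl, hlt 0⟩
        · have hx' : x ∈ Set.Ico (u (k + 1)) (u k) := hx
          exact ⟨(hlt (k + 1)).le.trans hx'.1, hx'.2.trans_le (hanti.antitone (Nat.zero_le k))⟩
      · rintro ⟨h1, h2⟩
        rcases h1.eq_or_lt with h | h
        · exact ⟨0, h.symm⟩
        · have hex : ∃ n, u n ≤ x := by
            obtain ⟨n, hn⟩ := exists_nat_one_div_lt (sub_pos.2 h)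
            exact ⟨n, by simp only [hu]; linarith⟩
          classical
          have hpos : Nat.find hex ≠ 0 := fun h0 => by
            have := Nat.find_spec hex
            rw [h0] at this
            linarith
          obtain ⟨k, hk⟩ := Nat.exists_eq_succ_of_ne_zero hpos
          refine ⟨k + 1, ?_⟩
          have h3 := Nat.find_spec hex
          rw [hk] at h3
          exact ⟨h3, not_le.1 (Nat.find_min hex (m := k) (by omega))⟩
    have hmeas : ∀ n, MeasurableSet (D n) := by
      rintro (_ | k)
      · exact measurableSet_singleton t
      · exact measurableSet_Ico
    have hsum := E.hasSum_proj D hmeas hdisj g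
    rw [hunion] at hsum
    have htail := (hasSum_nat_add_iff' 1).2 hsum
    rw [Finset.sum_range_one] at htail
    have h1 : E.proj (Set.Ico t (u 0)) g - E.proj {t} g ∈ V.topologicalClosure :=
      V.isClosed_topologicalClosure.mem_of_tendsto htail (Eventually.of_forall fun s =>
        Submodule.sum_mem _ fun n _ => hIco _ _)
    have h2 := V.topologicalClosure.sub_mem (hIco t (u 0)) h1
    rwa [sub_sub_cancel] at h2
  have hbi : ∀ i, b i ∈ V.topologicalClosure := by
    intro i
    have h1 : E.proj {a i} g = inner ℂ (b i) g • b i := by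
      refine b.eq_of_inner_eq fun j => ?_
      rw [hE, projectionValuedMeasure_proj, inner_smul_right]
      by_cases hj : j = i
      · rw [hj, b.inner_proj_of_mem (by simp), inner_self_eq_norm_sq_to_K, b.orthonormal.1 i]
        simp
      · rw [b.inner_proj_of_notMem (by simpa using fun h => hj (ha h)), b.orthonormal.2 hj,
          mul_zero]
    have h2 := V.topologicalClosure.smul_mem (inner ℂ (b i) g)⁻¹ (hsingle (a i))
    rwa [h1, inv_smul_smul₀ (hg i)] at h2
  rw [Submodule.dense_iff_topologicalClosure_eq_top, eq_top_iff, ← b.dense_span]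
  refine Submodule.topologicalClosure_minimal _ (Submodule.span_le.2 ?_)
    V.isClosed_topologicalClosure
  rintro _ ⟨i, rfl⟩
  exact hbi i

end HilbertBasis

end OperatorTheory

/-! ### Totality of the eigenvectors -/

/-- A quotient `f / s` of entire functions, `s` without zeros off the real line, vanishes if it is
`O(1 / |Im w|)` off the real line and `o(1 / y)` on the vertical ray above each real point: the
second condition excludes poles, and then the first gives `f / s = 0`. -/
theorem eq_zero_of_div_bounds {f s : ℂ → ℂ} (hf : Differentiable ℂ f) (hs : Differentiable ℂ s)
    (hs0 : ∀ w : ℂ, w.im ≠ 0 → s w ≠ 0) {K : ℝ}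
    (hK : ∀ w : ℂ, w.im ≠ 0 → ‖f w / s w‖ * |w.im| ≤ K)
    (hlim : ∀ t : ℝ, Tendsto (fun y : ℝ => y * ‖f (t + y * Complex.I) / s (t + y * Complex.I)‖)
      (𝓝[>] 0) (𝓝 0)) : f = 0 := by
  set q : ℂ → ℂ := fun w => f w / s w with hq
  have hqm : MeromorphicOn q Set.univ := fun w _ =>
    (hf.analyticAt w).meromorphicAt.div (hs.analyticAt w).meromorphicAt
  have hqa : ∀ w : ℂ, w.im ≠ 0 → AnalyticAt ℂ q w := fun w hw =>
    (hf.analyticAt w).div (hs.analyticAt w) (hs0 w hw)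
  have hord : ∀ w : ℂ, 0 ≤ meromorphicOrderAt q w := by
    intro w
    by_cases hw : w.im = 0
    · obtain ⟨t, rfl⟩ : ∃ t : ℝ, (t : ℂ) = w := ⟨w.re, Complex.ext rfl (by simp [hw])⟩
      by_contra! hneg
      obtain ⟨n, hn⟩ := WithTop.ne_top_iff_exists.1 hneg.ne_top
      rw [← hn] at hneg
      have hn0 : n < 0 := by exact_mod_cast hneg
      obtain ⟨g, hga, hg0, hqg⟩ := (meromorphicOrderAt_eq_int_iff (hqm t trivial)).1 hn.symm
      have hray : Tendsto (fun y : ℝ => (t : ℂ) + y * Complex.I) (𝓝[>] 0) (𝓝[≠] (t : ℂ)) := by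
        refine tendsto_nhdsWithin_iff.2 ⟨?_, ?_⟩
        · have : Continuous fun y : ℝ => (t : ℂ) + y * Complex.I := by fun_prop
          exact (this.tendsto' 0 (t : ℂ) (by simp)).mono_left nhdsWithin_le_nhds
        · filter_upwards [self_mem_nhdsWithin] with y hy
          have hy' : 0 < y := hy
          simpa using hy'.ne'
      have h1 : Tendsto (fun y : ℝ => ‖g ((t : ℂ) + y * Complex.I)‖) (𝓝[>] 0) (𝓝 ‖g t‖) :=
        (hga.continuousAt.tendsto.comp (hray.mono_right nhdsWithin_le_nhds)).norm
      refine (norm_pos_iff.2 hg0).not_ge (le_of_tendsto_of_tendsto h1 (hlim t) ?_)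
      have hlt1 : ∀ᶠ y : ℝ in 𝓝[>] 0, y < 1 := nhdsWithin_le_nhds (gt_mem_nhds one_pos)
      filter_upwards [hray.eventually hqg, self_mem_nhdsWithin, hlt1] with y hy hy0 hy1
      have hy0' : 0 < y := hy0
      have h2 : f (t + y * Complex.I) / s (t + y * Complex.I) =
          ((t : ℂ) + y * Complex.I - t) ^ n • g (t + y * Complex.I) := hy
      rw [h2, add_sub_cancel_left, norm_smul, norm_zpow, norm_mul, Complex.norm_I, mul_one,
        Complex.norm_real, Real.norm_of_nonneg hy0'.le, ← mul_assoc, ← zpow_one_add₀ hy0'.ne']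
      refine le_mul_of_one_le_left (norm_nonneg _) ?_
      exact one_le_zpow_of_nonpos₀ hy0' hy1.le (by omega)
    · exact (hqa w hw).meromorphicOrderAt_nonneg
  set Q := toMeromorphicNFOn q Set.univ with hQ
  have hQd : Differentiable ℂ Q := fun w =>
    ((meromorphicNFOn_toMeromorphicNFOn q Set.univ
      (Set.mem_univ w)).meromorphicOrderAt_nonneg_iff_analyticAt.1 (by
        rw [meromorphicOrderAt_toMeromorphicNFOn hqm (Set.mem_univ w)]
        exact hord w)).differentiableAt
  have hQq : ∀ w : ℂ, w.im ≠ 0 → Q w = q w := by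
    intro w hw
    rw [hQ, toMeromorphicNFOn_eq_toMeromorphicNFAt hqm (Set.mem_univ w),
      toMeromorphicNFAt_eq_self.2 (hqa w hw).meromorphicNFAt]
  have hQ0 : Q = 0 := eq_zero_of_norm_mul_abs_im_le hQd fun w hw => by
    rw [hQq w hw]
    exact hK w hw
  have hf0 : ∀ w : ℂ, w.im ≠ 0 → f w = 0 := by
    intro w hw
    have h1 := hQq w hw
    rw [hQ0] at h1
    exact (div_eq_zero_iff.1 h1.symm).resolve_right (hs0 w hw)
  have hopen : IsOpen {w : ℂ | w.im ≠ 0} := isOpen_ne_fun Complex.continuous_im continuous_const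
  refine AnalyticOnNhd.eq_of_eventuallyEq (𝕜 := ℂ) (z₀ := Complex.I) (fun z _ => hf.analyticAt z)
    (fun z _ => analyticAt_const) ?_
  filter_upwards [hopen.mem_nhds (show Complex.I ∈ {w : ℂ | w.im ≠ 0} by simp)] with w hw
  exact hf0 w hw

namespace HermiteBiehler

variable {e : HermiteBiehler}

theorem relation_fst_eq_zero (hs : e.s 0 ∈ e.functions) {β : ℝ} (hβ : Real.sin β ≠ 0)
    {p : e.Space × e.Space} (hp : p ∈ e.relation β) (h0 : p.1 = 0) : p.2 = 0 := by
  obtain ⟨c, hc⟩ := hp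
  have h1 := inner_s_zero hs hc
  rw [h0, inner_zero_right, eq_comm, mul_eq_zero] at h1
  have h2 : c = 0 := h1.resolve_left (neg_ne_zero.2 (mul_ne_zero
    (by exact_mod_cast Real.pi_ne_zero) (by exact_mod_cast hβ)))
  refine Space.ext fun z => ?_
  rw [hc, h0, h2, Space.zero_apply, mul_zero, zero_mul, add_zero]

/-- Eigenvectors are determined by their scalar product with `s_0`: if the latter vanishes, the
eigenvector `v` satisfies `(t - z) v(z) = 0`. -/
theorem eq_zero_of_inner_s_zero (hs : e.s 0 ∈ e.functions) {β : ℝ} (hβ : Real.sin β ≠ 0)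
    {t : ℂ} {v : e.Space} (hv : (v, t • v) ∈ e.relation β)
    (h0 : inner ℂ (Space.mk (e.s 0) hs) v = 0) : v = 0 := by
  obtain ⟨c, hc⟩ := hv
  have h1 := inner_s_zero hs hc
  rw [h0, eq_comm, mul_eq_zero] at h1
  have h2 : c = 0 := h1.resolve_left (neg_ne_zero.2 (mul_ne_zero
    (by exact_mod_cast Real.pi_ne_zero) (by exact_mod_cast hβ)))
  have h3 : ∀ z, z ≠ t → v z = 0 := by
    intro z hz
    have h4 := hc z
    simp only [h2, zero_mul, add_zero, Space.smul_apply] at h4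
    exact (mul_eq_mul_right_iff.1 h4).resolve_left hz.symm
  refine Space.ext fun z => ?_
  have h5 : (v : ℂ → ℂ) = fun _ => 0 :=
    Continuous.ext_on (dense_compl_singleton t) v.differentiable.continuous continuous_const
      fun z hz => h3 z hz
  rw [h5, Space.zero_apply]

/-- The operator `S_β`, obtained from its relation. The definition is meaningful if the relation is
the graph of an operator, see `graph_selfAdjointExtension`. -/
noncomputable def selfAdjointExtension (e : HermiteBiehler) (β : ℝ) : e.Space →ₗ.[ℂ] e.Space :=
  (e.relation β).toLinearPMap

theorem graph_selfAdjointExtension (hs : e.s 0 ∈ e.functions) {β : ℝ} (hβ : Real.sin β ≠ 0) :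
    (e.selfAdjointExtension β).graph = e.relation β :=
  Submodule.toLinearPMap_graph_eq _ fun _ hx h0 => relation_fst_eq_zero hs hβ hx h0

/-- A vector orthogonal to all eigenvectors vanishes. For `f` in the space, `f / s_β` at `w` is the
coefficient `c` of the resolvent `(S_β - w)⁻¹ f`, hence up to a constant the scalar product of
the resolvent with `s_0`; so the growth of `f / s_β` is controlled by the resolvent estimates. -/
theorem eq_zero_of_orthogonal_eigenvectors (hs : e.s 0 ∈ e.functions) {β : ℝ}
    (hβ : Real.sin β ≠ 0) {A : e.Space →ₗ.[ℂ] e.Space} (hgraph : A.graph = e.relation β)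
    (hA : A.graph.adjoint = A.graph) {f : e.Space}
    (hf : ∀ (t : ℝ) (v : e.Space), (v, (t : ℂ) • v) ∈ A.graph → inner ℂ v f = 0) : f = 0 := by
  have hsym : ∀ p ∈ A.graph, ∀ q ∈ A.graph, inner ℂ p.2 q.1 = inner ℂ p.1 q.2 := by
    rw [hgraph]
    exact fun p hp q hq => relation_symmetric hp hq
  set κ : ℝ := ‖Space.mk (e.s 0) hs‖ / (Real.pi * |Real.sin β|) with hκ
  have hpos : 0 < Real.pi * |Real.sin β| := mul_pos Real.pi_pos (abs_pos.2 hβ)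
  have hres : ∀ w : ℂ, w.im ≠ 0 → ∃ p ∈ A.graph, p.2 - w • p.1 = f ∧
      ‖f w / e.s β w‖ ≤ κ * ‖p.1‖ := by
    intro w hw
    obtain ⟨g, h, hc, hgh⟩ := exists_resolvent β hw f
    refine ⟨(g, h), by rw [hgraph]; exact ⟨_, hc⟩, hgh, ?_⟩
    have h1 := norm_inner_le_norm (𝕜 := ℂ) (Space.mk (e.s 0) hs) g
    rw [inner_s_zero hs hc, norm_mul, norm_neg, norm_mul, Complex.norm_real, Complex.norm_real,
      Real.norm_of_nonneg Real.pi_pos.le, Real.norm_eq_abs] at h1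
    rw [hκ, div_mul_eq_mul_div, le_div_iff₀ hpos]
    linarith
  have hκ0 : 0 ≤ κ := by positivity
  have h0 : (f : ℂ → ℂ) = 0 := by
    refine eq_zero_of_div_bounds f.differentiable (e.differentiable_s β)
      (fun w hw => s_ne_zero β hw) (K := κ * ‖f‖) (fun w hw => ?_) (fun t => ?_)
    · obtain ⟨p, hp, hpf, hle⟩ := hres w hw
      have h1 := abs_im_mul_norm_le_of_symmetric hsym hp w
      rw [hpf] at h1
      calc ‖f w / e.s β w‖ * |w.im| ≤ κ * ‖p.1‖ * |w.im| := by gcongr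
        _ = κ * (|w.im| * ‖p.1‖) := by ring
        _ ≤ κ * ‖f‖ := by gcongr
    · rw [Metric.tendsto_nhds]
      intro ε hε
      filter_upwards [eventually_mul_norm_le_of_orthogonal hA (hf t)
        (δ := ε / (2 * (κ + 1))) (by positivity), self_mem_nhdsWithin] with y hy hy0
      have hy0' : 0 < y := hy0
      obtain ⟨p, hp, hpf, hle⟩ := hres (t + y * Complex.I) (by simpa using hy0'.ne')
      rw [dist_zero_right, Real.norm_of_nonneg (by positivity)]
      calc y * ‖f (t + y * Complex.I) / e.s β (t + y * Complex.I)‖ ≤ y * (κ * ‖p.1‖) := by gcongr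
        _ = κ * (y * ‖p.1‖) := by ring
        _ ≤ κ * (ε / (2 * (κ + 1))) := by gcongr; exact hy p hp hpf
        _ ≤ (κ + 1) * (ε / (2 * (κ + 1))) := by gcongr; linarith
        _ = ε / 2 := by field_simp
        _ < ε := by linarith
  exact DFunLike.coe_injective h0

theorem isGeneratingVector_s_zero (hs : e.s 0 ∈ e.functions) {β : ℝ} (hβ : Real.sin β ≠ 0)
    {A : e.Space →ₗ.[ℂ] e.Space} (hgraph : A.graph = e.relation β)
    (hA : A.graph.adjoint = A.graph) : IsGeneratingVector A (Space.mk (e.s 0) hs) := by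
  set s₀ := Space.mk (e.s 0) hs with hs₀
  have hinner : ∀ {t : ℂ} {v : e.Space}, (v, t • v) ∈ A.graph → v ≠ 0 → inner ℂ s₀ v ≠ 0 := by
    intro t v hv hv0 h
    rw [hgraph] at hv
    exact hv0 (eq_zero_of_inner_s_zero hs hβ hv h)
  have hex : ∀ t : {t : ℝ // ∃ v : e.Space, v ≠ 0 ∧ (v, (t : ℂ) • v) ∈ A.graph},
      ∃ v : e.Space, ‖v‖ = 1 ∧ (v, ((t : ℝ) : ℂ) • v) ∈ A.graph := by
    rintro ⟨t, v, hv0, hv⟩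
    refine ⟨((‖v‖⁻¹ : ℝ) : ℂ) • v, ?_, ?_⟩
    · rw [norm_smul, Complex.norm_real, norm_inv, norm_norm,
        inv_mul_cancel₀ (norm_ne_zero_iff.2 hv0)]
    · have := A.graph.smul_mem ((‖v‖⁻¹ : ℝ) : ℂ) hv
      rwa [Prod.smul_mk, smul_comm] at this
  choose v hv1 hv using hex
  have hv0 : ∀ t, v t ≠ 0 := fun t h => by
    have := hv1 t
    rw [h, norm_zero] at this
    exact zero_ne_one this
  have horth : Orthonormal ℂ v := by
    refine ⟨hv1, fun t u htu => ?_⟩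
    have h3 := relation_symmetric (hgraph.le (hv t)) (hgraph.le (hv u))
    rw [inner_smul_left, inner_smul_right, Complex.conj_ofReal] at h3
    refine (mul_eq_mul_right_iff.1 h3).resolve_left fun h => htu (Subtype.ext ?_)
    exact_mod_cast h
  have htotal : (Submodule.span ℂ (Set.range v))ᗮ = ⊥ := by
    rw [Submodule.eq_bot_iff]
    intro f hf
    refine eq_zero_of_orthogonal_eigenvectors hs hβ hgraph hA fun t u hu => ?_
    by_cases hu0 : u = 0
    · rw [hu0, inner_zero_left]
    -- The eigenspaces are one-dimensional.
    set τ : {t : ℝ // ∃ v : e.Space, v ≠ 0 ∧ (v, (t : ℂ) • v) ∈ A.graph} := ⟨t, u, hu0, hu⟩ with hτ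
    set c := inner ℂ s₀ u / inner ℂ s₀ (v τ) with hc
    have h1 : u - c • v τ = 0 := by
      refine eq_zero_of_inner_s_zero hs hβ (t := (t : ℂ)) ?_ ?_
      · rw [← hgraph]
        have := A.graph.sub_mem hu (A.graph.smul_mem c (hv τ))
        rwa [Prod.smul_mk, Prod.mk_sub_mk, smul_comm c, ← smul_sub] at this
      · rw [inner_sub_right, inner_smul_right, hc, div_mul_cancel₀ _ (hinner (hv τ) (hv0 τ)),
          sub_self]
    rw [sub_eq_zero.1 h1, inner_smul_left, (Submodule.mem_orthogonal _ _).1 hf (v τ)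
      (Submodule.subset_span ⟨τ, rfl⟩), mul_zero]
  have hcoe := HilbertBasis.coe_mkOfOrthogonalEqBot horth htotal
  refine (HilbertBasis.mkOfOrthogonalEqBot horth htotal).isGeneratingVector hA
    Subtype.val_injective (fun t => ?_) (fun t h => ?_)
  · rw [hcoe]
    exact hv t
  · rw [hcoe] at h
    refine hinner (hv t) (hv0 t) ?_
    rw [← inner_conj_symm, h, map_zero]

theorem mulOp_le {β : ℝ} {A : e.Space →ₗ.[ℂ] e.Space} (hgraph : A.graph = e.relation β) :
    e.mulOp ≤ A := by
  refine LinearPMap.le_of_le_graph ?_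
  rw [hgraph]
  rintro p hp
  obtain ⟨f, hf⟩ := (LinearPMap.mem_graph_iff _).1 hp
  refine ⟨0, fun z => ?_⟩
  rw [← hf.1, ← hf.2, zero_mul, add_zero]
  rfl

end HermiteBiehler

theorem mainTheorem2 (e : HermiteBiehler) (hs : e.s 0 ∈ e.functions)
    (β : ℝ) (hβ : β ∈ Set.Ioo 0 Real.pi) :
    ∃ Sβ : e.Space →ₗ.[ℂ] e.Space,
      (Sβ.graph : Set (e.Space × e.Space)) = e.extensionGraph β ∧
      e.mulOp ≤ Sβ ∧
      IsSelfAdjointOperator Sβ ∧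
      IsGeneratingVector Sβ (HermiteBiehler.Space.mk (e.s 0) hs) := by
  have hsin : Real.sin β ≠ 0 := (Real.sin_pos_of_mem_Ioo hβ).ne'
  have hgraph := HermiteBiehler.graph_selfAdjointExtension hs hsin
  have hsa : IsSelfAdjointOperator (e.selfAdjointExtension β) := by
    refine IsSelfAdjointOperator.of_symmetric ?_ ?_
    · rw [hgraph]
      exact fun p hp q hq => HermiteBiehler.relation_symmetric hp hq
    · intro w hw f
      obtain ⟨g, h, hc, hgh⟩ := HermiteBiehler.exists_resolvent β hw f
      exact ⟨(g, h), by rw [hgraph]; exact ⟨_, hc⟩, hgh⟩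
  refine ⟨e.selfAdjointExtension β, ?_, HermiteBiehler.mulOp_le hgraph, hsa,
    HermiteBiehler.isGeneratingVector_s_zero hs hsin hgraph hsa.2⟩
  rw [hgraph, HermiteBiehler.coe_relation hsin]
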